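/- Let $\mathbb{T}^1=\mathbb{R}/2\pi\mathbb{Z}$, and let $\mathcal{S}(\mathbb{T}^1\times\mathbb{R})$ be the space of all $f\in C^\infty(\mathbb{T}^1\times\mathbb{R})$ (complex-valued) such that $$\|f\|_{\alpha,\beta,\gamma}=\sup_{(t,x)\in\mathbb{T}^1\times\mathbb{R}}|x^\gamma\partial_t^\alpha\partial_x^\beta f(t,x)|<\infty\quad\text{for all }\alpha,\beta,\gamma\in\mathbb{N}_0 .$$ Let $\mathcal{S}'(\mathbb{T}^1\times\mathbb{R})$ be the space of all linear functionals $u:\mathcal{S}(\mathbb{T}^1\times\mathbb{R})\to\mathbb{C}$ for which there are $N\in\mathbb{N}_0$ and $C>0$ with $|\langle u,f\rangle|\le C\sum_{\alpha+\beta+\gamma\le N}\|f\|_{\alpha,\beta,\gamma}$ for all $f\in\mathcal{S}(\mathbb{T}^1\times\mathbb{R})$. Identify $g\in\mathcal{S}(\mathbb{T}^1\times\mathbb{R})$ with the functional $f\mapsto\int_0^{2\pi}\int_{\mathbb{R}}g(t,x)f(t,x)\,dx\,dt$ in $\mathcal{S}'(\mathbb{T}^1\times\mathbb{R})$. Let $c,q\in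 C^\infty(\mathbb{T}^1)$ be complex-valued, let $b=\operatorname{Im}c$, and let $$c_0=\frac1{2\pi}\int_0^{2\pi}c(t)\,dt,\qquad q_0=\frac1{2\pi}\int_0^{2\pi}q(t)\,dt .$$ Let $L=\partial_t+c(t)\partial_x+q(t)$, acting on $\mathcal{S}'(\mathbb{T}^1\times\mathbb{R})$ in the sense of distributions. Call $L$ Schwartz globally hypoelliptic if every $u\in\mathcal{S}'(\mathbb{T}^1\times\mathbb{R})$ with $Lu\in\mathcal{S}(\mathbb{T}^1\times\mathbb{R})$ belongs to $\mathcal{S}(\mathbb{T}^1\times\mathbb{R})$. Then $L$ is Schwartz globally hypoelliptic if and only if both of the following hold: 1. the set $\{(k,\xi)\in\mathbb{Z}\times\mathbb{R}\;:\;k+c_0\xi-iq_0=0\}$ is empty; 2. $b$ does not change sign, that is, $b(t)\ge0$ for all $t\in\mathbb{T}^1$ or $b(t)\le0$ for all $t\in\mathbb{T}^1$. -/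

import Mathlib

open scoped ContDiff

noncomputable section

namespace TorusLine

/-! Functions on `𝕋¹ × ℝ`, where `𝕋¹ = ℝ / 2πℤ`, are functions of `(t, x) ∈ ℝ × ℝ` that are
`2π`-periodic in `t`; functions on `𝕋¹` are `2π`-periodic functions on `ℝ`. -/

/-- `C^∞(𝕋¹)`: the smooth complex-valued functions on the circle `ℝ / 2πℤ`. -/
def SmoothTorus : Submodule ℂ (ℝ → ℂ) where
  carrier := {a | ContDiff ℝ ∞ a ∧ Function.Periodic a (2 * Real.pi)}
  add_mem' ha hb := ⟨ha.1.add hb.1, ha.2.add hb.2⟩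
  zero_mem' := ⟨contDiff_const, fun _ => rfl⟩
  smul_mem' c _ ha := ⟨contDiff_const.smul ha.1, ha.2.smul c⟩

/-- The average `(2π)⁻¹ ∫₀^{2π} a(t) dt`. -/
def avg (a : SmoothTorus) : ℂ := (1 / (2 * Real.pi) : ℂ) * ∫ t in (0 : ℝ)..(2 * Real.pi), a.1 t

/-- The partial derivative `∂_t f` of a function of `(t, x)`. -/
def partialT (f : ℝ × ℝ → ℂ) : ℝ × ℝ → ℂ := fun p => deriv (fun s => f (s, p.2)) p.1

/-- The partial derivative `∂_x f` of a function of `(t, x)`. -/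
def partialX (f : ℝ × ℝ → ℂ) : ℝ × ℝ → ℂ := fun p => deriv (fun y => f (p.1, y)) p.2

/-- The function `x^γ ∂_t^α ∂_x^β f (t, x)`. -/
def weighted (α β γ : ℕ) (f : ℝ × ℝ → ℂ) : ℝ × ℝ → ℂ :=
  fun p => (p.2 : ℂ) ^ γ * (partialT^[α] (partialX^[β] f)) p

/-! ### Calculus of the partial derivatives -/

theorem partialT_eq {f : ℝ × ℝ → ℂ} (hf : ContDiff ℝ ∞ f) :
    partialT f = fun p => fderiv ℝ f p (1, 0) := by
  funext p
  have h1 : HasFDerivAt f (fderiv ℝ f p) (p.1, p.2) :=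
    (hf.differentiable (by simp) p).hasFDerivAt
  have h2 : HasDerivAt (fun s : ℝ => (s, p.2)) ((1 : ℝ), (0 : ℝ)) p.1 :=
    (hasDerivAt_id p.1).prodMk (hasDerivAt_const p.1 p.2)
  exact (h1.comp_hasDerivAt p.1 h2).deriv

theorem partialX_eq {f : ℝ × ℝ → ℂ} (hf : ContDiff ℝ ∞ f) :
    partialX f = fun p => fderiv ℝ f p (0, 1) := by
  funext p
  have h1 : HasFDerivAt f (fderiv ℝ f p) (p.1, p.2) :=
    (hf.differentiable (by simp) p).hasFDerivAt
  have h2 : HasDerivAt (fun y : ℝ => (p.1, y)) ((0 : ℝ), (1 : ℝ)) p.2 :=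
    (hasDerivAt_const p.2 p.1).prodMk (hasDerivAt_id p.2)
  exact (h1.comp_hasDerivAt p.2 h2).deriv

theorem contDiff_partialT {f : ℝ × ℝ → ℂ} (hf : ContDiff ℝ ∞ f) : ContDiff ℝ ∞ (partialT f) := by
  rw [partialT_eq hf]
  exact (hf.fderiv_right (m := ∞) (by simp)).clm_apply contDiff_const

theorem contDiff_partialX {f : ℝ × ℝ → ℂ} (hf : ContDiff ℝ ∞ f) : ContDiff ℝ ∞ (partialX f) := by
  rw [partialX_eq hf]
  exact (hf.fderiv_right (m := ∞) (by simp)).clm_apply contDiff_const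

theorem contDiff_partialT_iter {f : ℝ × ℝ → ℂ} (hf : ContDiff ℝ ∞ f) (n : ℕ) :
    ContDiff ℝ ∞ (partialT^[n] f) := by
  induction n with
  | zero => exact hf
  | succ n ih => rw [Function.iterate_succ_apply']; exact contDiff_partialT ih

theorem contDiff_partialX_iter {f : ℝ × ℝ → ℂ} (hf : ContDiff ℝ ∞ f) (n : ℕ) :
    ContDiff ℝ ∞ (partialX^[n] f) := by
  induction n with
  | zero => exact hf
  | succ n ih => rw [Function.iterate_succ_apply']; exact contDiff_partialX ih

theorem partialT_add {f g : ℝ × ℝ → ℂ} (hf : ContDiff ℝ ∞ f) (hg : ContDiff ℝ ∞ g) :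
    partialT (f + g) = partialT f + partialT g := by
  have hfg : ContDiff ℝ ∞ (f + g) := hf.add hg
  rw [partialT_eq hfg, partialT_eq hf, partialT_eq hg]
  funext p
  rw [fderiv_add (hf.differentiable (by simp) p) (hg.differentiable (by simp) p)]
  rfl

theorem partialX_add {f g : ℝ × ℝ → ℂ} (hf : ContDiff ℝ ∞ f) (hg : ContDiff ℝ ∞ g) :
    partialX (f + g) = partialX f + partialX g := by
  have hfg : ContDiff ℝ ∞ (f + g) := hf.add hg
  rw [partialX_eq hfg, partialX_eq hf, partialX_eq hg]
  funext p
  rw [fderiv_add (hf.differentiable (by simp) p) (hg.differentiable (by simp) p)]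
  rfl

theorem partialT_smul (c : ℂ) {f : ℝ × ℝ → ℂ} (hf : ContDiff ℝ ∞ f) :
    partialT (c • f) = c • partialT f := by
  have hcf : ContDiff ℝ ∞ (c • f) := contDiff_const.smul hf
  rw [partialT_eq hcf, partialT_eq hf]
  funext p
  rw [fderiv_const_smul (hf.differentiable (by simp) p)]
  rfl

theorem partialX_smul (c : ℂ) {f : ℝ × ℝ → ℂ} (hf : ContDiff ℝ ∞ f) :
    partialX (c • f) = c • partialX f := by
  have hcf : ContDiff ℝ ∞ (c • f) := contDiff_const.smul hf
  rw [partialX_eq hcf, partialX_eq hf]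
  funext p
  rw [fderiv_const_smul (hf.differentiable (by simp) p)]
  rfl

theorem partialT_iter_add {f g : ℝ × ℝ → ℂ} (hf : ContDiff ℝ ∞ f) (hg : ContDiff ℝ ∞ g) (n : ℕ) :
    partialT^[n] (f + g) = partialT^[n] f + partialT^[n] g := by
  induction n with
  | zero => rfl
  | succ n ih =>
    simp only [Function.iterate_succ_apply', ih]
    exact partialT_add (contDiff_partialT_iter hf n) (contDiff_partialT_iter hg n)

theorem partialX_iter_add {f g : ℝ × ℝ → ℂ} (hf : ContDiff ℝ ∞ f) (hg : ContDiff ℝ ∞ g) (n : ℕ) :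
    partialX^[n] (f + g) = partialX^[n] f + partialX^[n] g := by
  induction n with
  | zero => rfl
  | succ n ih =>
    simp only [Function.iterate_succ_apply', ih]
    exact partialX_add (contDiff_partialX_iter hf n) (contDiff_partialX_iter hg n)

theorem partialT_iter_smul (c : ℂ) {f : ℝ × ℝ → ℂ} (hf : ContDiff ℝ ∞ f) (n : ℕ) :
    partialT^[n] (c • f) = c • partialT^[n] f := by
  induction n with
  | zero => rfl
  | succ n ih =>
    simp only [Function.iterate_succ_apply', ih]
    exact partialT_smul c (contDiff_partialT_iter hf n)

theorem partialX_iter_smul (c : ℂ) {f : ℝ × ℝ → ℂ} (hf : ContDiff ℝ ∞ f) (n : ℕ) :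
    partialX^[n] (c • f) = c • partialX^[n] f := by
  induction n with
  | zero => rfl
  | succ n ih =>
    simp only [Function.iterate_succ_apply', ih]
    exact partialX_smul c (contDiff_partialX_iter hf n)

theorem weighted_add (α β γ : ℕ) {f g : ℝ × ℝ → ℂ} (hf : ContDiff ℝ ∞ f) (hg : ContDiff ℝ ∞ g) :
    weighted α β γ (f + g) = weighted α β γ f + weighted α β γ g := by
  funext p
  simp only [weighted, Pi.add_apply]
  rw [partialX_iter_add hf hg, partialT_iter_add (contDiff_partialX_iter hf β)
    (contDiff_partialX_iter hg β), Pi.add_apply, mul_add]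

theorem weighted_smul (α β γ : ℕ) (c : ℂ) {f : ℝ × ℝ → ℂ} (hf : ContDiff ℝ ∞ f) :
    weighted α β γ (c • f) = c • weighted α β γ f := by
  funext p
  simp only [weighted, Pi.smul_apply]
  rw [partialX_iter_smul c hf, partialT_iter_smul c (contDiff_partialX_iter hf β), Pi.smul_apply,
    smul_eq_mul, smul_eq_mul, mul_left_comm]

theorem partialX_partialT {f : ℝ × ℝ → ℂ} (hf : ContDiff ℝ ∞ f) :
    partialX (partialT f) = partialT (partialX f) := by
  rw [partialX_eq (contDiff_partialT hf), partialT_eq (contDiff_partialX hf), partialT_eq hf,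
    partialX_eq hf]
  funext p
  have hd : DifferentiableAt ℝ (fderiv ℝ f) p :=
    (hf.fderiv_right (m := ∞) (by simp)).differentiable (by simp) p
  have key : ∀ v w : ℝ × ℝ,
      fderiv ℝ (fun p => fderiv ℝ f p v) p w = fderiv ℝ (fderiv ℝ f) p w v := by
    intro v w
    rw [fderiv_clm_apply hd (differentiableAt_const v)]
    simp
  rw [key, key]
  have hs : IsSymmSndFDerivAt ℝ f p :=
    hf.contDiffAt.isSymmSndFDerivAt (by simpa using (WithTop.coe_le_coe.2 le_top : ((2 : ℕ∞) : WithTop ℕ∞) ≤ ∞))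
  exact hs.eq _ _

theorem partialX_iter_partialT {f : ℝ × ℝ → ℂ} (hf : ContDiff ℝ ∞ f) (n : ℕ) :
    partialX^[n] (partialT f) = partialT (partialX^[n] f) := by
  induction n with
  | zero => rfl
  | succ n ih =>
    simp only [Function.iterate_succ_apply', ih]
    exact partialX_partialT (contDiff_partialX_iter hf n)

theorem weighted_partialT (α β γ : ℕ) {f : ℝ × ℝ → ℂ} (hf : ContDiff ℝ ∞ f) :
    weighted α β γ (partialT f) = weighted (α + 1) β γ f := by
  funext p
  simp only [weighted]
  rw [partialX_iter_partialT hf, ← Function.iterate_succ_apply]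

theorem weighted_partialX (α β γ : ℕ) (f : ℝ × ℝ → ℂ) :
    weighted α β γ (partialX f) = weighted α (β + 1) γ f := rfl

theorem contDiff_mulT {a : ℝ → ℂ} (ha : ContDiff ℝ ∞ a) {f : ℝ × ℝ → ℂ} (hf : ContDiff ℝ ∞ f) :
    ContDiff ℝ ∞ (fun p : ℝ × ℝ => a p.1 * f p) :=
  (ha.comp contDiff_fst).mul hf

theorem partialX_iter_mul {a : ℝ → ℂ} {f : ℝ × ℝ → ℂ} (n : ℕ) :
    partialX^[n] (fun p : ℝ × ℝ => a p.1 * f p) = fun p => a p.1 * (partialX^[n] f) p := by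
  induction n with
  | zero => rfl
  | succ n ih =>
    simp only [Function.iterate_succ_apply', ih]
    funext p
    simp only [partialX]
    exact deriv_const_mul_field _

theorem partialT_mul {a : ℝ → ℂ} (ha : ContDiff ℝ ∞ a) {f : ℝ × ℝ → ℂ} (hf : ContDiff ℝ ∞ f) :
    partialT (fun p : ℝ × ℝ => a p.1 * f p) =
      (fun p : ℝ × ℝ => deriv a p.1 * f p) + fun p : ℝ × ℝ => a p.1 * partialT f p := by
  funext p
  have hs : DifferentiableAt ℝ (fun s : ℝ => f (s, p.2)) p.1 :=
    ((hf.comp (contDiff_id.prodMk contDiff_const)).differentiable (by simp)) p.1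
  exact deriv_fun_mul (ha.differentiable (by simp) p.1) hs

/-- A bound that comes from the Leibniz rule. -/
theorem exists_leibniz_bound (α : ℕ) : ∀ a ∈ SmoothTorus, ∃ C : ℝ, 0 ≤ C ∧
    ∀ f : ℝ × ℝ → ℂ, ContDiff ℝ ∞ f → ∀ p : ℝ × ℝ,
      ‖(partialT^[α] (fun p : ℝ × ℝ => a p.1 * f p)) p‖ ≤
        C * ∑ j ∈ Finset.range (α + 1), ‖(partialT^[j] f) p‖ := by
  induction α with
  | zero =>
    intro a ha
    obtain ⟨C, hC⟩ := (ha.2.isBounded_of_continuous (by positivity) ha.1.continuous).exists_norm_le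
    refine ⟨C, (norm_nonneg _).trans (hC (a 0) ⟨0, rfl⟩), fun f _ p => ?_⟩
    simp only [Function.iterate_zero, id, zero_add, Finset.range_one, Finset.sum_singleton,
      norm_mul]
    exact mul_le_mul_of_nonneg_right (hC _ ⟨_, rfl⟩) (norm_nonneg _)
  | succ n ih =>
    intro a ha
    have hda : deriv a ∈ SmoothTorus := by
      refine ⟨?_, fun t => ?_⟩
      · exact (contDiff_infty_iff_deriv.1 ha.1).2
      · rw [← deriv_comp_add_const]
        congr 1
        exact funext ha.2
    obtain ⟨C, hC0, hC⟩ := ih a ha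
    obtain ⟨D, hD0, hD⟩ := ih (deriv a) hda
    refine ⟨C + D, add_nonneg hC0 hD0, fun f hf p => ?_⟩
    rw [Function.iterate_succ_apply, partialT_mul ha.1 hf,
      partialT_iter_add (contDiff_mulT hda.1 hf) (contDiff_mulT ha.1 (contDiff_partialT hf)),
      Pi.add_apply]
    have h1 := hC (partialT f) (contDiff_partialT hf) p
    have h2 := hD f hf p
    have e1 : ∑ j ∈ Finset.range (n + 1), ‖(partialT^[j] (partialT f)) p‖ ≤
        ∑ j ∈ Finset.range (n + 1 + 1), ‖(partialT^[j] f) p‖ := by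
      rw [Finset.sum_range_succ' _ (n + 1)]
      simp only [Function.iterate_succ_apply]
      linarith [norm_nonneg ((partialT^[0] f) p)]
    have e2 : ∑ j ∈ Finset.range (n + 1), ‖(partialT^[j] f) p‖ ≤
        ∑ j ∈ Finset.range (n + 1 + 1), ‖(partialT^[j] f) p‖ := by
      rw [Finset.sum_range_succ _ (n + 1)]
      linarith [norm_nonneg ((partialT^[n + 1] f) p)]
    calc _ ≤ _ := norm_add_le _ _
      _ ≤ _ := add_le_add (h2.trans (mul_le_mul_of_nonneg_left e2 hD0))
          (h1.trans (mul_le_mul_of_nonneg_left e1 hC0))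
      _ = _ := by ring

/-! ### The Schwartz space of `𝕋¹ × ℝ` -/

/-- `𝒮(𝕋¹ × ℝ)`: smooth functions of `(t, x)`, `2π`-periodic in `t`, with all the functions
`x^γ ∂_t^α ∂_x^β f` bounded. -/
def Schwartz : Submodule ℂ (ℝ × ℝ → ℂ) where
  carrier := {f | ContDiff ℝ ∞ f ∧ (∀ t x : ℝ, f (t + 2 * Real.pi, x) = f (t, x)) ∧
    ∀ α β γ : ℕ, BddAbove (Set.range fun p : ℝ × ℝ => ‖weighted α β γ f p‖)}
  add_mem' := by
    rintro f g ⟨hf, hfp, hfb⟩ ⟨hg, hgp, hgb⟩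
    refine ⟨hf.add hg, fun t x => by simp [hfp, hgp], fun α β γ => ?_⟩
    obtain ⟨C, hC⟩ := hfb α β γ
    obtain ⟨D, hD⟩ := hgb α β γ
    refine ⟨C + D, ?_⟩
    rintro _ ⟨p, rfl⟩
    simp only [weighted_add α β γ hf hg, Pi.add_apply]
    exact (norm_add_le _ _).trans (add_le_add (hC ⟨p, rfl⟩) (hD ⟨p, rfl⟩))
  zero_mem' := by
    refine ⟨contDiff_const, fun _ _ => rfl, fun α β γ => ⟨0, ?_⟩⟩
    rintro _ ⟨p, rfl⟩
    have h := weighted_smul α β γ 0 (f := 0) contDiff_const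
    rw [zero_smul, zero_smul] at h
    simp [h]
  smul_mem' := by
    rintro c f ⟨hf, hfp, hfb⟩
    refine ⟨contDiff_const.smul hf, fun t x => by simp [hfp], fun α β γ => ?_⟩
    obtain ⟨C, hC⟩ := hfb α β γ
    refine ⟨‖c‖ * C, ?_⟩
    rintro _ ⟨p, rfl⟩
    simp only [weighted_smul α β γ c hf, Pi.smul_apply, norm_smul]
    exact mul_le_mul_of_nonneg_left (hC ⟨p, rfl⟩) (norm_nonneg _)

/-- The seminorm `‖f‖_{α,β,γ} = sup_{t,x} |x^γ ∂_t^α ∂_x^β f(t, x)|`. -/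
def snorm (α β γ : ℕ) (f : Schwartz) : ℝ := ⨆ p : ℝ × ℝ, ‖weighted α β γ f.1 p‖

/-- The multi-indices `(α, β, γ)` with `α + β + γ ≤ N`. -/
def indices (N : ℕ) : Finset (ℕ × ℕ × ℕ) :=
  (Finset.range (N + 1) ×ˢ Finset.range (N + 1) ×ˢ Finset.range (N + 1)).filter
    fun i => i.1 + i.2.1 + i.2.2 ≤ N

/-- The seminorm `p_N(f) = ∑_{α+β+γ ≤ N} ‖f‖_{α,β,γ}`. -/
def pNorm (N : ℕ) (f : Schwartz) : ℝ := ∑ i ∈ indices N, snorm i.1 i.2.1 i.2.2 f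

theorem mem_indices {N : ℕ} {i : ℕ × ℕ × ℕ} : i ∈ indices N ↔ i.1 + i.2.1 + i.2.2 ≤ N := by
  simp only [indices, Finset.mem_filter, Finset.mem_product, Finset.mem_range]
  omega

theorem le_snorm (α β γ : ℕ) (f : Schwartz) (p : ℝ × ℝ) :
    ‖weighted α β γ f.1 p‖ ≤ snorm α β γ f :=
  le_ciSup (f.2.2.2 α β γ) p

theorem snorm_nonneg (α β γ : ℕ) (f : Schwartz) : 0 ≤ snorm α β γ f :=
  (norm_nonneg _).trans (le_snorm α β γ f 0)

theorem pNorm_nonneg (N : ℕ) (f : Schwartz) : 0 ≤ pNorm N f :=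
  Finset.sum_nonneg fun _ _ => snorm_nonneg _ _ _ f

theorem snorm_le_pNorm {N α β γ : ℕ} (h : α + β + γ ≤ N) (f : Schwartz) :
    snorm α β γ f ≤ pNorm N f := by
  have key : ∀ (s : Finset (ℕ × ℕ × ℕ)) (F : ℕ × ℕ × ℕ → ℝ), (∀ i, 0 ≤ F i) →
      ∀ i ∈ s, F i ≤ ∑ j ∈ s, F j := fun s F hF i hi =>
    Finset.single_le_sum (fun j _ => hF j) hi
  have hi : (α, β, γ) ∈ indices N := by
    rw [mem_indices]
    exact h
  exact key (indices N) (fun i => snorm i.1 i.2.1 i.2.2 f) (fun i => snorm_nonneg _ _ _ f)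
    (α, β, γ) hi

theorem pNorm_mono {M N : ℕ} (h : M ≤ N) (f : Schwartz) : pNorm M f ≤ pNorm N f :=
  Finset.sum_le_sum_of_subset_of_nonneg
    (fun _ hi => mem_indices.2 ((mem_indices.1 hi).trans h)) fun _ _ _ => snorm_nonneg _ _ _ f

/-- `∂_t` on Schwartz functions. -/
def schwartzDT : Schwartz →ₗ[ℂ] Schwartz where
  toFun f := ⟨partialT f.1, contDiff_partialT f.2.1, by
    intro t x
    have h : (fun s => f.1 (s, x)) = fun s => f.1 (s + 2 * Real.pi, x) :=
      funext fun s => (f.2.2.1 s x).symm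
    simp only [partialT]
    conv_rhs => rw [h]
    rw [deriv_comp_add_const (fun s => f.1 (s, x))], fun α β γ => by
      rw [weighted_partialT α β γ f.2.1]; exact f.2.2.2 (α + 1) β γ⟩
  map_add' f g := Subtype.ext (partialT_add f.2.1 g.2.1)
  map_smul' c f := Subtype.ext (partialT_smul c f.2.1)

/-- `∂_x` on Schwartz functions. -/
def schwartzDX : Schwartz →ₗ[ℂ] Schwartz where
  toFun f := ⟨partialX f.1, contDiff_partialX f.2.1, fun t x => by
    simp only [partialX]
    congr 1
    exact funext fun y => f.2.2.1 t y, fun α β γ => f.2.2.2 α (β + 1) γ⟩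
  map_add' f g := Subtype.ext (partialX_add f.2.1 g.2.1)
  map_smul' c f := Subtype.ext (partialX_smul c f.2.1)

theorem exists_weighted_mul_bound (a : SmoothTorus) (α : ℕ) : ∃ C : ℝ, 0 ≤ C ∧
    ∀ (β γ : ℕ) (f : Schwartz) (p : ℝ × ℝ), ‖weighted α β γ (fun p => a.1 p.1 * f.1 p) p‖ ≤
      C * ∑ j ∈ Finset.range (α + 1), snorm j β γ f := by
  obtain ⟨C, hC0, hC⟩ := exists_leibniz_bound α a.1 a.2
  refine ⟨C, hC0, fun β γ f p => ?_⟩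
  simp only [weighted, partialX_iter_mul, norm_mul]
  calc _ ≤ _ := mul_le_mul_of_nonneg_left (hC _ (contDiff_partialX_iter f.2.1 β) p)
        (norm_nonneg _)
    _ = C * ∑ j ∈ Finset.range (α + 1), ‖weighted j β γ f.1 p‖ := by
        rw [mul_left_comm, Finset.mul_sum]
        simp only [weighted, norm_mul]
    _ ≤ _ := mul_le_mul_of_nonneg_left (Finset.sum_le_sum fun j _ => le_snorm j β γ f p) hC0

/-- Multiplication of Schwartz functions by a smooth function `a(t)`. -/
def schwartzMul (a : SmoothTorus) : Schwartz →ₗ[ℂ] Schwartz where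
  toFun f := ⟨fun p => a.1 p.1 * f.1 p, contDiff_mulT a.2.1 f.2.1, fun t x => by
    simp only [a.2.2 t, f.2.2.1 t x], fun α β γ => by
      obtain ⟨C, -, hC⟩ := exists_weighted_mul_bound a α
      refine ⟨C * ∑ j ∈ Finset.range (α + 1), snorm j β γ f, ?_⟩
      rintro _ ⟨p, rfl⟩
      exact hC β γ f p⟩
  map_add' f g := Subtype.ext (funext fun p => mul_add _ (f.1 p) (g.1 p))
  map_smul' c f := Subtype.ext (funext fun p => mul_left_comm _ c (f.1 p))

theorem pNorm_schwartzDT_le (N : ℕ) : ∃ C : ℝ, ∀ f, pNorm N (schwartzDT f) ≤ C * pNorm (N + 1) f := by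
  refine ⟨(indices N).card, fun f => ?_⟩
  rw [← nsmul_eq_mul]
  refine Finset.sum_le_card_nsmul _ _ _ fun i hi => ?_
  have h := mem_indices.1 hi
  have e : snorm i.1 i.2.1 i.2.2 (schwartzDT f) = snorm (i.1 + 1) i.2.1 i.2.2 f := by
    simp only [snorm, schwartzDT, LinearMap.coe_mk, AddHom.coe_mk, weighted_partialT _ _ _ f.2.1]
  rw [e]
  exact snorm_le_pNorm (by omega) f

theorem pNorm_schwartzDX_le (N : ℕ) : ∃ C : ℝ, ∀ f, pNorm N (schwartzDX f) ≤ C * pNorm (N + 1) f := by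
  refine ⟨(indices N).card, fun f => ?_⟩
  rw [← nsmul_eq_mul]
  refine Finset.sum_le_card_nsmul _ _ _ fun i hi => ?_
  have h := mem_indices.1 hi
  have e : snorm i.1 i.2.1 i.2.2 (schwartzDX f) = snorm i.1 (i.2.1 + 1) i.2.2 f := rfl
  rw [e]
  exact snorm_le_pNorm (by omega) f

theorem pNorm_schwartzMul_le (a : SmoothTorus) (N : ℕ) :
    ∃ C : ℝ, ∀ f, pNorm N (schwartzMul a f) ≤ C * pNorm N f := by
  choose C hC0 hC using exists_weighted_mul_bound a
  refine ⟨∑ i ∈ indices N, C i.1 * (i.1 + 1 : ℕ), fun f => ?_⟩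
  rw [Finset.sum_mul]
  refine Finset.sum_le_sum fun i hi => ?_
  have h := mem_indices.1 hi
  refine ciSup_le fun p => (hC i.1 i.2.1 i.2.2 f p).trans ?_
  rw [mul_assoc]
  refine mul_le_mul_of_nonneg_left ?_ (hC0 _)
  have := Finset.sum_le_card_nsmul (Finset.range (i.1 + 1)) (fun j => snorm j i.2.1 i.2.2 f)
    (pNorm N f) fun j hj => snorm_le_pNorm (by rw [Finset.mem_range] at hj; omega) f
  simpa using this

/-! ### Tempered distributions on `𝕋¹ × ℝ` -/

/-- `𝒮'(𝕋¹ × ℝ)`: the linear functionals `u` on `𝒮(𝕋¹ × ℝ)` with `|⟨u, f⟩| ≤ C p_N(f)` for some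
`N` and `C`. -/
def Tempered : Submodule ℂ (Schwartz →ₗ[ℂ] ℂ) where
  carrier := {u | ∃ (N : ℕ) (C : ℝ), ∀ f, ‖u f‖ ≤ C * pNorm N f}
  add_mem' := by
    rintro u v ⟨M, C, hC⟩ ⟨N, D, hD⟩
    refine ⟨max M N, |C| + |D|, fun f => ?_⟩
    have h1 : C * pNorm M f ≤ |C| * pNorm (max M N) f :=
      mul_le_mul (le_abs_self C) (pNorm_mono (le_max_left _ _) f) (pNorm_nonneg _ f) (abs_nonneg C)
    have h2 : D * pNorm N f ≤ |D| * pNorm (max M N) f :=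
      mul_le_mul (le_abs_self D) (pNorm_mono (le_max_right _ _) f) (pNorm_nonneg _ f) (abs_nonneg D)
    rw [LinearMap.add_apply, add_mul]
    exact (norm_add_le _ _).trans (add_le_add ((hC f).trans h1) ((hD f).trans h2))
  zero_mem' := ⟨0, 0, fun f => by simp⟩
  smul_mem' := by
    rintro c u ⟨N, C, hC⟩
    refine ⟨N, ‖c‖ * C, fun f => ?_⟩
    rw [LinearMap.smul_apply, norm_smul, mul_assoc]
    exact mul_le_mul_of_nonneg_left (hC f) (norm_nonneg _)

/-- Composition of a tempered distribution with a linear map that is continuous for the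
seminorms `p_N`. -/
def transpose (A : Schwartz →ₗ[ℂ] Schwartz)
    (hA : ∀ N : ℕ, ∃ (M : ℕ) (C : ℝ), ∀ f, pNorm N (A f) ≤ C * pNorm M f) :
    Tempered →ₗ[ℂ] Tempered where
  toFun u := ⟨u.1 ∘ₗ A, by
    obtain ⟨N, C, hC⟩ := u.2
    obtain ⟨M, D, hD⟩ := hA N
    refine ⟨M, |C| * D, fun f => ?_⟩
    calc ‖(u.1 ∘ₗ A) f‖ ≤ C * pNorm N (A f) := hC (A f)
      _ ≤ |C| * pNorm N (A f) := mul_le_mul_of_nonneg_right (le_abs_self C) (pNorm_nonneg _ _)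
      _ ≤ |C| * (D * pNorm M f) := mul_le_mul_of_nonneg_left (hD f) (abs_nonneg C)
      _ = _ := (mul_assoc _ _ _).symm⟩
  map_add' _ _ := rfl
  map_smul' _ _ := rfl

/-- `∂_t` on tempered distributions: `⟨∂_t u, f⟩ = -⟨u, ∂_t f⟩`. -/
def distDT : Tempered →ₗ[ℂ] Tempered :=
  -transpose schwartzDT fun N => ⟨N + 1, pNorm_schwartzDT_le N⟩

/-- `∂_x` on tempered distributions: `⟨∂_x u, f⟩ = -⟨u, ∂_x f⟩`. -/
def distDX : Tempered →ₗ[ℂ] Tempered :=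
  -transpose schwartzDX fun N => ⟨N + 1, pNorm_schwartzDX_le N⟩

/-- Multiplication of tempered distributions by `a(t)`: `⟨a u, f⟩ = ⟨u, a f⟩`. -/
def distMul (a : SmoothTorus) : Tempered →ₗ[ℂ] Tempered :=
  transpose (schwartzMul a) fun N => ⟨N, pNorm_schwartzMul_le a N⟩

/-- The strip `(0, 2π] × ℝ`, a fundamental domain of `𝕋¹ × ℝ`. -/
def strip : Set (ℝ × ℝ) := Set.Ioc 0 (2 * Real.pi) ×ˢ Set.univ

theorem integrableOn_weight :
    MeasureTheory.IntegrableOn (fun p : ℝ × ℝ => (1 + p.2 ^ 2)⁻¹) strip := by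
  have h1 : MeasureTheory.Integrable (fun _ : ℝ => (1 : ℝ))
      (MeasureTheory.volume.restrict (Set.Ioc 0 (2 * Real.pi))) :=
    MeasureTheory.integrable_const 1
  have h := h1.mul_prod integrable_inv_one_add_sq
  simp only [one_mul] at h
  rw [MeasureTheory.IntegrableOn, strip, MeasureTheory.Measure.volume_eq_prod,
    ← MeasureTheory.Measure.prod_restrict, MeasureTheory.Measure.restrict_univ]
  exact h

theorem integrableOn_schwartz (g : Schwartz) : MeasureTheory.IntegrableOn g.1 strip := by
  refine (integrableOn_weight.const_mul (snorm 0 0 0 g + snorm 0 0 2 g)).mono'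
    g.2.1.continuous.aestronglyMeasurable (Filter.Eventually.of_forall fun p => ?_)
  have h0 := le_snorm 0 0 0 g p
  have h2 := le_snorm 0 0 2 g p
  simp only [weighted, Function.iterate_zero, id, pow_zero, one_mul, norm_mul, norm_pow,
    Complex.norm_real, Real.norm_eq_abs, sq_abs] at h0 h2
  have hp : 0 < 1 + p.2 ^ 2 := by positivity
  rw [← div_eq_mul_inv, le_div_iff₀ hp]
  nlinarith

theorem norm_le_snorm (f : Schwartz) (p : ℝ × ℝ) : ‖f.1 p‖ ≤ snorm 0 0 0 f := by
  simpa [weighted] using le_snorm 0 0 0 f p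

theorem integrableOn_mul (g f : Schwartz) :
    MeasureTheory.IntegrableOn (fun p => g.1 p * f.1 p) strip :=
  (integrableOn_schwartz g).mul_bdd f.2.1.continuous.aestronglyMeasurable
    (Filter.Eventually.of_forall fun p => norm_le_snorm f p)

/-- The tempered distribution `f ↦ ∫_{𝕋¹ × ℝ} g f dt dx` given by a Schwartz function `g`. -/
def toTempered (g : Schwartz) : Tempered :=
  ⟨{ toFun := fun f => ∫ p in strip, g.1 p * f.1 p
     map_add' := fun f h => by
      rw [← MeasureTheory.integral_add (integrableOn_mul g f) (integrableOn_mul g h)]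
      exact MeasureTheory.integral_congr_ae
        (Filter.Eventually.of_forall fun p => mul_add _ (f.1 p) (h.1 p))
     map_smul' := fun c f => by
      rw [RingHom.id_apply, smul_eq_mul, ← MeasureTheory.integral_const_mul]
      exact MeasureTheory.integral_congr_ae
        (Filter.Eventually.of_forall fun p => mul_left_comm _ c (f.1 p)) },
    0, ∫ p in strip, ‖g.1 p‖, fun f => by
      rw [← MeasureTheory.integral_mul_const]
      refine MeasureTheory.norm_integral_le_of_norm_le
        ((integrableOn_schwartz g).norm.mul_const _) (Filter.Eventually.of_forall fun p => ?_)
      rw [norm_mul]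
      exact mul_le_mul_of_nonneg_left
        ((norm_le_snorm f p).trans (snorm_le_pNorm (le_refl 0) f)) (norm_nonneg _)⟩

/-- A map `L : 𝒮' → 𝒮'` is Schwartz globally hypoelliptic if `L u ∈ 𝒮` with `u ∈ 𝒮'` forces
`u ∈ 𝒮`. -/
def IsSchwartzGloballyHypoelliptic (L : Tempered →ₗ[ℂ] Tempered) : Prop :=
  ∀ u : Tempered, (∃ f : Schwartz, L u = toTempered f) → ∃ g : Schwartz, u = toTempered g

/-- The operator `L = ∂_t + c(t) ∂_x + q(t)` on `𝒮'(𝕋¹ × ℝ)`. -/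
def vectorFieldOp (c q : SmoothTorus) : Tempered →ₗ[ℂ] Tempered :=
  distDT + distMul c ∘ₗ distDX + distMul q

/-- The set `{(k, ξ) ∈ ℤ × ℝ | k + c₀ ξ - i q₀ = 0}`. -/
def zeroSet (c₀ q₀ : ℂ) : Set (ℤ × ℝ) :=
  {p | (p.1 : ℂ) + c₀ * (p.2 : ℂ) - Complex.I * q₀ = 0}

end TorusLine

end

/-! The Fourier transform in `x` turns `L` into the family of equations `v' + (2πiξ c + q) v = F` on
the circle, with `ξ` real. Such an equation is uniquely solvable in periodic functions iff `exp
(2π(2πiξ c₀ + q₀)) ≠ 1`, and condition 1 says that this holds for every `ξ`.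

Sufficiency. If `b` has one sign, then for each `ξ` the real part of the coefficient is bounded on
one side independently of `ξ`. Integrating over one period, forwards or backwards, bounds `v` by `F`
up to the factor `|1 - exp(±2π(2πiξ c₀ + q₀))|`, which stays away from `0`: as `ξ` is a continuous
variable, condition 1 leaves no small divisors (`exists_le_norm_one_sub_exp`). The resulting
estimate, uniform in `ξ` (`exists_norm_solution_le`), carries over to all derivatives, so `L` is
onto on the Schwartz space. The same holds for `∂_t + c ∂_x - q`, which is minus the transpose of
`L`. If `Lu = Lv` with `v` Schwartz, then `u - v` annihilates the range of the transpose, which is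
everything; hence `u = v` (`isSchwartzGloballyHypoelliptic_of_surjective`).

Necessity of 1. A point of the zero set gives a frequency at which the homogeneous equation has a
periodic solution without zeros. Carried by that single frequency, it is a distribution in the
kernel of `L` that is not a function on the Fourier side (`lineDist_ne_toTempered`).

Necessity of 2. If `b` goes from negative to positive along an arc, a primitive of `b` has an
interior minimum `t₀` there. The exponential solution normalised at `t₀` is bounded on the arc as `ξ
→ +∞`, does not decay at `t₀`, and decays exponentially near the ends. Cut off in `t` near the ends
and in `ξ` near `0`, it solves the equation up to a Schwartz error without being Schwartz
(`not_isSchwartzGloballyHypoelliptic_of_cutoff`). -/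

noncomputable section

namespace TorusLine

open MeasureTheory
open scoped FourierTransform

/-! ### Smoothness from partial derivatives -/

/-- If the partial derivatives of the members of a family of continuous functions belong to the
family, then its members are smooth. -/
theorem contDiff_of_partials_mem (K : Set (ℝ × ℝ → ℂ)) (hc : ∀ f ∈ K, Continuous f)
    (hT : ∀ f ∈ K, ∃ g ∈ K, ∀ p : ℝ × ℝ, HasDerivAt (fun s => f (s, p.2)) (g p) p.1)
    (hX : ∀ f ∈ K, ∃ g ∈ K, ∀ p : ℝ × ℝ, HasDerivAt (fun y => f (p.1, y)) (g p) p.2)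
    {f : ℝ × ℝ → ℂ} (hf : f ∈ K) : ContDiff ℝ ∞ f := by
  suffices h : ∀ n : ℕ, ∀ f ∈ K, ContDiff ℝ n f from contDiff_infty.2 fun n => h n f hf
  intro n
  induction n with
  | zero => exact fun f hf => contDiff_zero.2 (hc f hf)
  | succ n ih =>
    intro f hf
    obtain ⟨g, hg, hfg⟩ := hT f hf
    obtain ⟨k, hk, hfk⟩ := hX f hf
    let T : ℂ →L[ℝ] ℝ →L[ℝ] ℂ := ContinuousLinearMap.toSpanSingletonCLE.toContinuousLinearMap
    -- Continuous partial derivatives assemble into a total derivative. It is built linearly from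
    -- two members of the family, so it is `C^n` by induction.
    refine contDiff_succ_iff_hasFDerivAt.2
      ⟨fun p => (T (g p)).comp (.fst ℝ ℝ ℝ) + (T (k p)).comp (.snd ℝ ℝ ℝ), ?_, fun p => ?_⟩
    · exact ((T.contDiff.comp (ih g hg)).clm_comp contDiff_const).add
        ((T.contDiff.comp (ih k hk)).clm_comp contDiff_const)
    · have h := hasStrictFDerivAt_uncurry_coprod (𝕜 := ℝ) (u := p) (f := fun t x => f (t, x))
        (f₁ := fun t x => T (g (t, x))) (f₂ := fun t x => T (k (t, x)))
        (Filter.Eventually.of_forall fun v => (hfg v).hasFDerivAt)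
        (Filter.Eventually.of_forall fun v => (hfk v).hasFDerivAt)
        (T.continuous.comp (hc g hg)).continuousAt (T.continuous.comp (hc k hk)).continuousAt
      exact h.hasFDerivAt

theorem hasDerivAt_partialT {f : ℝ × ℝ → ℂ} (hf : ContDiff ℝ ∞ f) (t x : ℝ) :
    HasDerivAt (fun s => f (s, x)) (partialT f (t, x)) t :=
  (((hf.comp (contDiff_id.prodMk contDiff_const)).differentiable (by simp)) t).hasDerivAt

theorem hasDerivAt_partialX {f : ℝ × ℝ → ℂ} (hf : ContDiff ℝ ∞ f) (t x : ℝ) :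
    HasDerivAt (fun y => f (t, y)) (partialX f (t, x)) x :=
  (((hf.comp (contDiff_const.prodMk contDiff_id)).differentiable (by simp)) x).hasDerivAt

theorem contDiff_smul_const {f : ℝ × ℝ → ℂ} (hf : ContDiff ℝ ∞ f) (c : ℂ) :
    ContDiff ℝ ∞ (c • f) :=
  contDiff_const.smul hf

theorem contDiff_add_fun {f g : ℝ × ℝ → ℂ} (hf : ContDiff ℝ ∞ f) (hg : ContDiff ℝ ∞ g) :
    ContDiff ℝ ∞ (f + g) :=
  hf.add hg

/-- Multiplication by the second variable. -/
def mulX (f : ℝ × ℝ → ℂ) : ℝ × ℝ → ℂ := fun p => (p.2 : ℂ) * f p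

theorem contDiff_mulX {f : ℝ × ℝ → ℂ} (hf : ContDiff ℝ ∞ f) : ContDiff ℝ ∞ (mulX f) :=
  (Complex.ofRealCLM.contDiff.comp contDiff_snd).mul hf

theorem partialT_iter_mulX (f : ℝ × ℝ → ℂ) (n : ℕ) :
    partialT^[n] (mulX f) = mulX (partialT^[n] f) := by
  induction n with
  | zero => rfl
  | succ n ih =>
    simp only [Function.iterate_succ_apply', ih]
    funext p
    simp only [partialT, mulX]
    exact deriv_const_mul_field _

theorem partialX_mulX {f : ℝ × ℝ → ℂ} (hf : ContDiff ℝ ∞ f) :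
    partialX (mulX f) = mulX (partialX f) + f := by
  funext p
  have h := (Complex.ofRealCLM.hasDerivAt (x := p.2)).mul (hasDerivAt_partialX hf p.1 p.2)
  simp only [Complex.ofRealCLM_apply, Complex.ofReal_one, one_mul] at h
  simp only [mulX, Pi.add_apply]
  rw [add_comm]
  exact h.deriv

theorem partialX_iter_mulX {f : ℝ × ℝ → ℂ} (hf : ContDiff ℝ ∞ f) (n : ℕ) :
    partialX^[n + 1] (mulX f) = mulX (partialX^[n + 1] f) + (n + 1 : ℂ) • partialX^[n] f := by
  induction n with
  | zero => simp [partialX_mulX hf]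
  | succ n ih =>
    rw [Function.iterate_succ_apply', ih, partialX_add (contDiff_mulX (contDiff_partialX_iter hf _))
      (contDiff_smul_const (contDiff_partialX_iter hf _) _),
      partialX_mulX (contDiff_partialX_iter hf _), partialX_smul _ (contDiff_partialX_iter hf _),
      ← Function.iterate_succ_apply' partialX n, ← Function.iterate_succ_apply' partialX (n + 1)]
    push_cast
    module

theorem weighted_zero_mulX (α γ : ℕ) (f : ℝ × ℝ → ℂ) :
    weighted α 0 γ (mulX f) = weighted α 0 (γ + 1) f := by
  funext p
  simp only [weighted, Function.iterate_zero, id, partialT_iter_mulX, mulX]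
  ring

theorem weighted_succ_mulX (α β γ : ℕ) {f : ℝ × ℝ → ℂ} (hf : ContDiff ℝ ∞ f) :
    weighted α (β + 1) γ (mulX f) =
      weighted α (β + 1) (γ + 1) f + (β + 1 : ℂ) • weighted α β γ f := by
  funext p
  simp only [weighted, Pi.add_apply, Pi.smul_apply, smul_eq_mul]
  rw [partialX_iter_mulX hf, partialT_iter_add (contDiff_mulX (contDiff_partialX_iter hf _))
    (contDiff_smul_const (contDiff_partialX_iter hf _) _), partialT_iter_mulX,
    partialT_iter_smul _ (contDiff_partialX_iter hf _)]
  simp only [mulX, Pi.add_apply, Pi.smul_apply, smul_eq_mul]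
  ring

/-! ### Rapid decrease with a bounded number of derivatives in `t` -/

/-- All `x^γ ∂_t^α ∂_x^β f` with `α ≤ n` are bounded. -/
def RapidlyDecreasing (n : ℕ) (f : ℝ × ℝ → ℂ) : Prop :=
  ∀ α ≤ n, ∀ β γ : ℕ, ∃ C : ℝ, ∀ p, ‖weighted α β γ f p‖ ≤ C

theorem mem_schwartz_iff {f : ℝ × ℝ → ℂ} : f ∈ Schwartz ↔ ContDiff ℝ ∞ f ∧
    (∀ t x : ℝ, f (t + 2 * Real.pi, x) = f (t, x)) ∧ ∀ n, RapidlyDecreasing n f := by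
  refine and_congr_right fun _ => and_congr_right fun _ => ⟨fun h n α _ β γ => ?_,
    fun h α β γ => ?_⟩
  · obtain ⟨C, hC⟩ := h α β γ
    exact ⟨C, fun p => hC ⟨p, rfl⟩⟩
  · obtain ⟨C, hC⟩ := h α α le_rfl β γ
    exact ⟨C, by rintro _ ⟨p, rfl⟩; exact hC p⟩

theorem RapidlyDecreasing.add {n : ℕ} {f g : ℝ × ℝ → ℂ} (hf : RapidlyDecreasing n f)
    (hg : RapidlyDecreasing n g) (hfs : ContDiff ℝ ∞ f) (hgs : ContDiff ℝ ∞ g) :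
    RapidlyDecreasing n (f + g) := by
  intro α hα β γ
  obtain ⟨C, hC⟩ := hf α hα β γ
  obtain ⟨D, hD⟩ := hg α hα β γ
  refine ⟨C + D, fun p => ?_⟩
  rw [weighted_add α β γ hfs hgs]
  exact (norm_add_le _ _).trans (add_le_add (hC p) (hD p))

theorem RapidlyDecreasing.smul {n : ℕ} {f : ℝ × ℝ → ℂ} (hf : RapidlyDecreasing n f)
    (hfs : ContDiff ℝ ∞ f) (c : ℂ) : RapidlyDecreasing n (c • f) := by
  intro α hα β γ
  obtain ⟨C, hC⟩ := hf α hα β γ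
  refine ⟨‖c‖ * C, fun p => ?_⟩
  rw [weighted_smul α β γ c hfs, Pi.smul_apply, norm_smul]
  exact mul_le_mul_of_nonneg_left (hC p) (norm_nonneg _)

theorem RapidlyDecreasing.mulX {n : ℕ} {f : ℝ × ℝ → ℂ} (hf : RapidlyDecreasing n f)
    (hfs : ContDiff ℝ ∞ f) : RapidlyDecreasing n (mulX f) := by
  rintro α hα (_ | β) γ
  · rw [weighted_zero_mulX]
    exact hf α hα 0 (γ + 1)
  · obtain ⟨C, hC⟩ := hf α hα (β + 1) (γ + 1)
    obtain ⟨D, hD⟩ := hf α hα β γ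
    refine ⟨C + ‖(β + 1 : ℂ)‖ * D, fun p => ?_⟩
    rw [weighted_succ_mulX α β γ hfs, Pi.add_apply, Pi.smul_apply]
    refine (norm_add_le _ _).trans (add_le_add (hC p) ?_)
    rw [norm_smul]
    exact mul_le_mul_of_nonneg_left (hD p) (norm_nonneg _)

theorem RapidlyDecreasing.mulT {n : ℕ} {f : ℝ × ℝ → ℂ} (hf : RapidlyDecreasing n f)
    (hfs : ContDiff ℝ ∞ f) {a : ℝ → ℂ} (ha : a ∈ SmoothTorus) :
    RapidlyDecreasing n (fun p => a p.1 * f p) := by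
  intro α hα β γ
  obtain ⟨C, hC0, hC⟩ := exists_leibniz_bound α a ha
  have h : ∀ j, ∃ D : ℝ, j ≤ n → ∀ p, ‖weighted j β γ f p‖ ≤ D := by
    intro j
    by_cases hj : j ≤ n
    · obtain ⟨D, hD⟩ := hf j hj β γ
      exact ⟨D, fun _ => hD⟩
    · exact ⟨0, fun h => absurd h hj⟩
  choose D hD using h
  refine ⟨C * ∑ j ∈ Finset.range (α + 1), D j, fun p => ?_⟩
  simp only [weighted, partialX_iter_mul, norm_mul]
  calc _ ≤ _ := mul_le_mul_of_nonneg_left (hC _ (contDiff_partialX_iter hfs β) p)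
        (norm_nonneg _)
    _ = C * ∑ j ∈ Finset.range (α + 1), ‖weighted j β γ f p‖ := by
        rw [mul_left_comm, Finset.mul_sum]
        simp only [weighted, norm_mul]
    _ ≤ _ := mul_le_mul_of_nonneg_left (Finset.sum_le_sum fun j hj =>
        hD j (by rw [Finset.mem_range] at hj; omega) p) hC0

/-- This is why `t`-derivatives are counted separately: the differential equation expresses `∂_t f`
through `f` and `x f`, so control of `n` derivatives in `t` propagates to `n + 1`. -/
theorem RapidlyDecreasing.succ {n : ℕ} {f : ℝ × ℝ → ℂ} (hf : RapidlyDecreasing n f)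
    (hfs : ContDiff ℝ ∞ f) (hT : RapidlyDecreasing n (partialT f)) :
    RapidlyDecreasing (n + 1) f := by
  rintro (_ | α) hα β γ
  · exact hf 0 (Nat.zero_le _) β γ
  · rw [← weighted_partialT α β γ hfs]
    exact hT α (by omega) β γ

/-- Multiplication by `x` on Schwartz functions. -/
def schwartzX : Schwartz →ₗ[ℂ] Schwartz where
  toFun f := ⟨mulX f.1, mem_schwartz_iff.2 ⟨contDiff_mulX f.2.1,
    fun t x => by simp only [mulX, f.2.2.1], fun n =>
      ((mem_schwartz_iff.1 f.2).2.2 n).mulX f.2.1⟩⟩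
  map_add' f g := Subtype.ext (funext fun p => mul_add _ (f.1 p) (g.1 p))
  map_smul' c f := Subtype.ext (funext fun p => mul_left_comm _ c (f.1 p))

theorem pow_mul_eq_iterate_mulX (n : ℕ) (g : ℝ × ℝ → ℂ) :
    (fun p : ℝ × ℝ => (p.2 : ℂ) ^ n * g p) = mulX^[n] g := by
  induction n generalizing g with
  | zero => simp
  | succ n ih =>
    rw [Function.iterate_succ_apply, ← ih]
    funext p
    simp only [mulX]
    ring

/-- A smooth function that is periodic in `t` and of compact support in `x` is a Schwartz
function. -/
theorem mem_schwartz_of_support {f : ℝ × ℝ → ℂ} (hf : ContDiff ℝ ∞ f)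
    (hp : ∀ t x : ℝ, f (t + 2 * Real.pi, x) = f (t, x)) {R : ℝ}
    (hR : ∀ t x : ℝ, R < |x| → f (t, x) = 0) : f ∈ Schwartz := by
  -- This class is stable under `∂_t`, `∂_x` and multiplication by `x`, and its members are bounded
  -- by compactness of one period times `[-R, R]`.
  let K : Set (ℝ × ℝ → ℂ) := {f | ContDiff ℝ ∞ f ∧
    (∀ t x : ℝ, f (t + 2 * Real.pi, x) = f (t, x)) ∧ ∀ t x : ℝ, R < |x| → f (t, x) = 0}
  have hKT : ∀ f ∈ K, partialT f ∈ K := by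
    rintro f ⟨h1, h2, h3⟩
    refine ⟨contDiff_partialT h1, fun t x => ?_, fun t x hx => ?_⟩
    · have h : (fun s => f (s, x)) = fun s => f (s + 2 * Real.pi, x) :=
        funext fun s => (h2 s x).symm
      simp only [partialT]
      conv_rhs => rw [h]
      rw [deriv_comp_add_const (fun s => f (s, x))]
    · simp [partialT, h3 _ x hx]
  have hKX : ∀ f ∈ K, partialX f ∈ K := by
    rintro f ⟨h1, h2, h3⟩
    refine ⟨contDiff_partialX h1, fun t x => ?_, fun t x hx => ?_⟩
    · simp [partialX, h2]
    · have : (fun y => f (t, y)) =ᶠ[nhds x] fun _ => 0 := by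
        filter_upwards [(isOpen_lt continuous_const continuous_abs).mem_nhds hx] with y hy
        exact h3 t y hy
      simp [partialX, this.deriv_eq]
  have hKM : ∀ f ∈ K, mulX f ∈ K := fun f h =>
    ⟨contDiff_mulX h.1, fun t x => by simp only [mulX, h.2.1], fun t x hx => by
      simp [mulX, h.2.2 t x hx]⟩
  have hb : ∀ f ∈ K, ∃ C : ℝ, ∀ p, ‖f p‖ ≤ C := by
    rintro f ⟨h1, h2, h3⟩
    obtain ⟨C, hC⟩ := (isCompact_Icc.prod isCompact_Icc).exists_bound_of_continuousOn
      (s := Set.Icc 0 (2 * Real.pi) ×ˢ Set.Icc (-R) R) h1.continuous.continuousOn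
    refine ⟨max C 0, fun p => ?_⟩
    by_cases hx : R < |p.2|
    · rw [← Prod.mk.eta (p := p), h3 _ _ hx]
      simp
    · obtain ⟨s, hs, he⟩ := Function.Periodic.exists_mem_Ico₀ (f := fun t => f (t, p.2))
        (fun t => h2 t p.2) Real.two_pi_pos p.1
      rw [← Prod.mk.eta (p := p), he]
      exact (hC (s, p.2) ⟨⟨hs.1, hs.2.le⟩, abs_le.1 (not_lt.1 hx)⟩).trans (le_max_left _ _)
  have iter : ∀ (F : (ℝ × ℝ → ℂ) → ℝ × ℝ → ℂ), (∀ f ∈ K, F f ∈ K) → ∀ n, ∀ f ∈ K, F^[n] f ∈ K := by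
    intro F hF n
    induction n with
    | zero => exact fun f h => h
    | succ n ih => exact fun f h => ih _ (hF f h)
  refine mem_schwartz_iff.2 ⟨hf, hp, fun n α _ β γ => ?_⟩
  have := hb _ (iter mulX hKM γ _ (iter partialT hKT α _ (iter partialX hKX β f ⟨hf, hp, hR⟩)))
  rw [← pow_mul_eq_iterate_mulX] at this
  exact this

/-! ### The Fourier transform in the second variable -/

theorem norm_le_weight (f : Schwartz) (p : ℝ × ℝ) :
    ‖f.1 p‖ ≤ (snorm 0 0 0 f + snorm 0 0 2 f) * (1 + p.2 ^ 2)⁻¹ := by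
  have h0 := le_snorm 0 0 0 f p
  have h2 := le_snorm 0 0 2 f p
  simp only [weighted, Function.iterate_zero, id, pow_zero, one_mul, norm_mul, norm_pow,
    Complex.norm_real, Real.norm_eq_abs, sq_abs] at h0 h2
  have hp : 0 < 1 + p.2 ^ 2 := by positivity
  rw [← div_eq_mul_inv, le_div_iff₀ hp]
  nlinarith

theorem continuous_slice (f : Schwartz) (t : ℝ) : Continuous fun x => f.1 (t, x) :=
  f.2.1.continuous.comp (by fun_prop)

theorem integrable_slice (f : Schwartz) (t : ℝ) : Integrable fun x => f.1 (t, x) :=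
  (integrable_inv_one_add_sq.const_mul _).mono' (continuous_slice f t).aestronglyMeasurable
    (Filter.Eventually.of_forall fun x => norm_le_weight f (t, x))

theorem integrable_slice_mul (f g : Schwartz) (t : ℝ) :
    Integrable fun x => f.1 (t, x) * g.1 (t, x) :=
  (integrable_slice f t).mul_bdd (continuous_slice g t).aestronglyMeasurable
    (Filter.Eventually.of_forall fun x => norm_le_snorm g (t, x))

/-- The Fourier transform in the second variable. -/
def fourierX (f : ℝ × ℝ → ℂ) : ℝ × ℝ → ℂ := fun p => 𝓕 (fun x => f (p.1, x)) p.2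

theorem fourierX_eq (f : ℝ × ℝ → ℂ) (p : ℝ × ℝ) :
    fourierX f p = ∫ x, (Real.fourierChar (-(x * p.2)) : ℂ) * f (p.1, x) := by
  simp only [fourierX, Real.fourier_real_eq, Circle.smul_def, smul_eq_mul]

theorem norm_fourierX_le (f : Schwartz) (p : ℝ × ℝ) :
    ‖fourierX f.1 p‖ ≤ (snorm 0 0 0 f + snorm 0 0 2 f) * Real.pi := by
  rw [fourierX_eq, ← integral_univ_inv_one_add_sq, ← integral_const_mul]
  refine norm_integral_le_of_norm_le (integrable_inv_one_add_sq.const_mul _)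
    (Filter.Eventually.of_forall fun x => ?_)
  rw [norm_mul, Circle.norm_coe, one_mul]
  exact norm_le_weight f (p.1, x)

theorem continuous_fourierX (f : Schwartz) : Continuous (fourierX f.1) := by
  have hk : Continuous fun q : (ℝ × ℝ) × ℝ =>
      (Real.fourierChar (-(q.2 * q.1.2)) : ℂ) * f.1 (q.1.1, q.2) :=
    (continuous_subtype_val.comp (Real.continuous_fourierChar.comp (by fun_prop))).mul
      (f.2.1.continuous.comp (by fun_prop))
  rw [funext (fourierX_eq f.1)]
  refine continuous_of_dominated
    (bound := fun x => (snorm 0 0 0 f + snorm 0 0 2 f) * (1 + x ^ 2)⁻¹) (fun p => ?_)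
    (fun p => Filter.Eventually.of_forall fun x => ?_) (integrable_inv_one_add_sq.const_mul _)
    (Filter.Eventually.of_forall fun x =>
      hk.comp (by fun_prop : Continuous fun p : ℝ × ℝ => (p, x)))
  · exact (hk.comp (by fun_prop : Continuous fun x : ℝ => (p, x))).aestronglyMeasurable
  · rw [norm_mul, Circle.norm_coe, one_mul]
    exact norm_le_weight f (p.1, x)

theorem hasDerivAt_fourierX_fst (f : Schwartz) (p : ℝ × ℝ) :
    HasDerivAt (fun s => fourierX f.1 (s, p.2)) (fourierX (schwartzDT f).1 p) p.1 := by
  have hm : ∀ (g : Schwartz) (t : ℝ), Continuous fun x : ℝ =>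
      (Real.fourierChar (-(x * p.2)) : ℂ) * g.1 (t, x) := fun g t =>
    (continuous_subtype_val.comp (Real.continuous_fourierChar.comp (by fun_prop))).mul
      (continuous_slice g t)
  simp only [fourierX_eq]
  refine (hasDerivAt_integral_of_dominated_loc_of_deriv_le (μ := volume) (s := Set.univ)
    (F := fun t x => (Real.fourierChar (-(x * p.2)) : ℂ) * f.1 (t, x))
    (F' := fun t x => (Real.fourierChar (-(x * p.2)) : ℂ) * (schwartzDT f).1 (t, x))
    (bound := fun x => (snorm 0 0 0 (schwartzDT f) + snorm 0 0 2 (schwartzDT f)) * (1 + x ^ 2)⁻¹)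
    Filter.univ_mem (Filter.Eventually.of_forall fun t => (hm f t).aestronglyMeasurable) ?_
    (hm _ _).aestronglyMeasurable (Filter.Eventually.of_forall fun x t _ => ?_)
    (integrable_inv_one_add_sq.const_mul _) (Filter.Eventually.of_forall fun x t _ => ?_)).2
  · refine (integrable_slice f p.1).norm.mono' (hm f p.1).aestronglyMeasurable
      (Filter.Eventually.of_forall fun x => ?_)
    rw [norm_mul, Circle.norm_coe, one_mul]
  · rw [norm_mul, Circle.norm_coe, one_mul]
    exact norm_le_weight (schwartzDT f) (t, x)
  · exact (hasDerivAt_partialT f.2.1 t x).const_mul _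

theorem hasDerivAt_fourierX_snd (f : Schwartz) (p : ℝ × ℝ) :
    HasDerivAt (fun y => fourierX f.1 (p.1, y))
      (fourierX (((-2 * Real.pi * Complex.I : ℂ) • schwartzX f).1) p) p.2 := by
  have h := Real.hasDerivAt_fourier (integrable_slice f p.1)
    ((integrable_slice (schwartzX f) p.1).congr (Filter.Eventually.of_forall fun x => by
      simp [schwartzX, mulX])) p.2
  have e : (fun x => ((-2 * Real.pi * Complex.I : ℂ) • schwartzX f).1 (p.1, x)) =
      fun x : ℝ => (-2 * Real.pi * Complex.I * x : ℂ) • f.1 (p.1, x) := by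
    funext x
    simp [schwartzX, mulX]
    ring
  rw [fourierX, e]
  exact h

theorem fourierX_partialX (f : Schwartz) (p : ℝ × ℝ) :
    fourierX (schwartzDX f).1 p = 2 * Real.pi * Complex.I * p.2 * fourierX f.1 p := by
  have hd : deriv (fun x => f.1 (p.1, x)) = fun x => (schwartzDX f).1 (p.1, x) := rfl
  have h := Real.fourier_deriv (integrable_slice f p.1)
    (fun x => (hasDerivAt_partialX f.2.1 p.1 x).differentiableAt)
    (hd ▸ integrable_slice (schwartzDX f) p.1)
  rw [hd] at h
  exact congrFun h p.2

/-- Both partial derivatives of a transform are again transforms of Schwartz functions, so the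
family of all transforms is closed under them. -/
theorem contDiff_fourierX (f : Schwartz) : ContDiff ℝ ∞ (fourierX f.1) := by
  refine contDiff_of_partials_mem (Set.range fun f : Schwartz => fourierX f.1) ?_ ?_ ?_ ⟨f, rfl⟩
  · rintro _ ⟨f, rfl⟩
    exact continuous_fourierX f
  · rintro _ ⟨f, rfl⟩
    exact ⟨_, ⟨schwartzDT f, rfl⟩, hasDerivAt_fourierX_fst f⟩
  · rintro _ ⟨f, rfl⟩
    exact ⟨_, ⟨_, rfl⟩, hasDerivAt_fourierX_snd f⟩

theorem partialT_fourierX (f : Schwartz) :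
    partialT (fourierX f.1) = fourierX (schwartzDT f).1 :=
  funext fun p => (hasDerivAt_fourierX_fst f p).deriv

theorem partialX_fourierX (f : Schwartz) :
    partialX (fourierX f.1) = fourierX ((-2 * Real.pi * Complex.I : ℂ) • schwartzX f).1 :=
  funext fun p => (hasDerivAt_fourierX_snd f p).deriv

theorem exists_iterate_eq_fourierX {F : (ℝ × ℝ → ℂ) → ℝ × ℝ → ℂ}
    (hF : ∀ f : Schwartz, ∃ g : Schwartz, F (fourierX f.1) = fourierX g.1) (n : ℕ) (f : Schwartz) :
    ∃ g : Schwartz, F^[n] (fourierX f.1) = fourierX g.1 := by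
  induction n generalizing f with
  | zero => exact ⟨f, rfl⟩
  | succ n ih =>
    obtain ⟨g, hg⟩ := hF f
    rw [Function.iterate_succ_apply, hg]
    exact ih g

theorem fourierX_smul (c : ℂ) (f : Schwartz) : fourierX (c • f).1 = c • fourierX f.1 := by
  funext p
  simp only [fourierX_eq, Pi.smul_apply, smul_eq_mul, ← integral_const_mul]
  exact integral_congr_ae (Filter.Eventually.of_forall fun x => mul_left_comm _ c _)

theorem fourierX_add (f g : Schwartz) : fourierX (f + g).1 = fourierX f.1 + fourierX g.1 := by
  have hi : ∀ (f : Schwartz) (p : ℝ × ℝ), Integrable fun x : ℝ =>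
      (Real.fourierChar (-(x * p.2)) : ℂ) * f.1 (p.1, x) := fun f p => by
    refine (integrable_slice f p.1).norm.mono' ((continuous_subtype_val.comp
      (Real.continuous_fourierChar.comp (by fun_prop))).mul
      (continuous_slice f p.1)).aestronglyMeasurable (Filter.Eventually.of_forall fun x => ?_)
    rw [norm_mul, Circle.norm_coe, one_mul]
  funext p
  simp only [fourierX_eq, Pi.add_apply]
  rw [← integral_add (hi f p) (hi g p)]
  exact integral_congr_ae (Filter.Eventually.of_forall fun x => mul_add _ (f.1 _) (g.1 _))

theorem mulX_fourierX (f : Schwartz) :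
    mulX (fourierX f.1) =
      fourierX ((2 * Real.pi * Complex.I : ℂ)⁻¹ • schwartzDX f).1 := by
  funext p
  rw [fourierX_smul, Pi.smul_apply, fourierX_partialX, smul_eq_mul, mulX]
  have := Complex.two_pi_I_ne_zero
  field_simp

/-- The Fourier transform in the second variable, as a map of the Schwartz space. -/
def fourier : Schwartz →ₗ[ℂ] Schwartz where
  toFun f := ⟨fourierX f.1, mem_schwartz_iff.2 ⟨contDiff_fourierX f,
    fun t x => by simp only [fourierX, f.2.2.1], fun _ α _ β γ => by
      -- Derivatives and powers of `ξ` are absorbed into the function being transformed, so each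
      -- weighted derivative is itself a transform `fourierX l.1`, hence bounded.
      obtain ⟨g, hg⟩ := exists_iterate_eq_fourierX (fun f => ⟨_, partialX_fourierX f⟩) β f
      obtain ⟨k, hk⟩ := exists_iterate_eq_fourierX (fun f => ⟨_, partialT_fourierX f⟩) α g
      obtain ⟨l, hl⟩ := exists_iterate_eq_fourierX (fun f => ⟨_, mulX_fourierX f⟩) γ k
      have : weighted α β γ (fourierX f.1) = fourierX l.1 := by
        rw [← hl, ← hk, ← hg, ← pow_mul_eq_iterate_mulX]
        rfl
      exact ⟨_, fun p => this ▸ norm_fourierX_le l p⟩⟩⟩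
  map_add' f g := Subtype.ext (fourierX_add f g)
  map_smul' c f := Subtype.ext (fourierX_smul c f)

theorem fourier_schwartzDT (f : Schwartz) : fourier (schwartzDT f) = schwartzDT (fourier f) :=
  Subtype.ext (partialT_fourierX f).symm

theorem fourier_schwartzDX (f : Schwartz) :
    fourier (schwartzDX f) = (2 * Real.pi * Complex.I : ℂ) • schwartzX (fourier f) := by
  refine Subtype.ext (funext fun p => (fourierX_partialX f p).trans ?_)
  change _ = 2 * Real.pi * Complex.I * ((p.2 : ℂ) * fourierX f.1 p)
  ring

theorem fourier_schwartzMul (a : SmoothTorus) (f : Schwartz) :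
    fourier (schwartzMul a f) = schwartzMul a (fourier f) := by
  refine Subtype.ext (funext fun p => ?_)
  change fourierX (fun p => a.1 p.1 * f.1 p) p = a.1 p.1 * fourierX f.1 p
  rw [fourierX_eq, fourierX_eq, ← integral_const_mul]
  exact integral_congr_ae (Filter.Eventually.of_forall fun x => mul_left_comm _ (a.1 p.1) _)

theorem fourier_fourier_apply (f : Schwartz) (t x : ℝ) :
    (fourier (fourier f)).1 (t, x) = f.1 (t, -x) := by
  have h := (continuous_slice f t).fourierInv_fourier_eq (integrable_slice f t)
    (integrable_slice (fourier f) t)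
  rw [← congrFun h (-x), Real.fourierInv_eq_fourier_neg, neg_neg]
  rfl

/-- Applying the transform twice reflects `x`. Consequently the third iterate serves as the inverse
throughout. -/
theorem fourier_iterate_four (f : Schwartz) : fourier (fourier (fourier (fourier f))) = f := by
  refine Subtype.ext (funext fun p => ?_)
  rw [← Prod.mk.eta (p := p), fourier_fourier_apply, fourier_fourier_apply, neg_neg]

theorem fourier_injective : Function.Injective fourier := fun f g h => by
  rw [← fourier_iterate_four f, h, fourier_iterate_four]

theorem integral_slice_fourier_mul (f g : Schwartz) (t : ℝ) :
    ∫ x, (fourier f).1 (t, x) * g.1 (t, x) = ∫ x, f.1 (t, x) * (fourier g).1 (t, x) := by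
  have h := VectorFourier.integral_fourierIntegral_smul_eq_flip (L := innerₗ ℝ)
    Real.continuous_fourierChar continuous_inner (integrable_slice f t) (integrable_slice g t)
  rw [flip_innerₗ] at h
  exact h

theorem integral_strip {F : ℝ × ℝ → ℂ} (hF : IntegrableOn F strip) :
    ∫ p in strip, F p = ∫ t in (0 : ℝ)..(2 * Real.pi), ∫ x, F (t, x) := by
  rw [intervalIntegral.integral_of_le Real.two_pi_pos.le]
  have := setIntegral_prod (μ := volume) (ν := volume) F (s := Set.Ioc 0 (2 * Real.pi))
    (t := Set.univ) hF
  rw [setIntegral_congr_fun measurableSet_Ioc fun t _ => (setIntegral_univ)] at this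
  exact this

theorem integral_strip_swap {F : ℝ × ℝ → ℂ} (hF : IntegrableOn F strip) :
    ∫ p in strip, F p = ∫ x, ∫ t in (0 : ℝ)..(2 * Real.pi), F (t, x) := by
  rw [IntegrableOn, strip, Measure.volume_eq_prod, ← Measure.prod_restrict,
    Measure.restrict_univ] at hF
  rw [strip, Measure.volume_eq_prod, ← Measure.prod_restrict, Measure.restrict_univ,
    integral_prod_symm F hF]
  simp only [intervalIntegral.integral_of_le Real.two_pi_pos.le]

theorem integral_strip_fourier_mul (f g : Schwartz) :
    ∫ p in strip, (fourier f).1 p * g.1 p = ∫ p in strip, f.1 p * (fourier g).1 p := by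
  rw [integral_strip (integrableOn_mul _ _), integral_strip (integrableOn_mul _ _)]
  simp only [integral_slice_fourier_mul]

/-- Two derivatives in `x` pay for the weight `1 + ξ²`, and integrability in `x` costs two more
powers of `x`, whence `p_4`. This makes pairings of bounded functions with `fourier f` tempered. -/
theorem norm_fourier_le_weight (f : Schwartz) (p : ℝ × ℝ) :
    ‖(fourier f).1 p‖ ≤ 4 * Real.pi * pNorm 4 f * (1 + p.2 ^ 2)⁻¹ := by
  have h0 := norm_fourierX_le f p
  have h2 := norm_fourierX_le (schwartzDX (schwartzDX f)) p
  rw [fourierX_partialX, fourierX_partialX] at h2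
  have b1 : snorm 0 0 0 f ≤ pNorm 4 f := snorm_le_pNorm (by norm_num) f
  have b2 : snorm 0 0 2 f ≤ pNorm 4 f := snorm_le_pNorm (by norm_num) f
  have b3 : snorm 0 0 0 (schwartzDX (schwartzDX f)) ≤ pNorm 4 f :=
    snorm_le_pNorm (α := 0) (β := 2) (γ := 0) (by norm_num) f
  have b4 : snorm 0 0 2 (schwartzDX (schwartzDX f)) ≤ pNorm 4 f :=
    snorm_le_pNorm (α := 0) (β := 2) (γ := 2) (by norm_num) f
  have hπ := Real.pi_gt_three
  simp only [norm_mul, Complex.norm_real, Complex.norm_I, Complex.norm_ofNat, mul_one,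
    Real.norm_eq_abs, abs_of_pos Real.pi_pos] at h2
  change ‖fourierX f.1 p‖ ≤ _
  rw [← div_eq_mul_inv, le_div_iff₀ (by positivity)]
  have e : 2 * Real.pi * |p.2| * (2 * Real.pi * |p.2| * ‖fourierX f.1 p‖) =
      (4 * Real.pi ^ 2) * (p.2 ^ 2 * ‖fourierX f.1 p‖) := by
    rw [← sq_abs p.2]; ring
  rw [e] at h2
  have h3 : p.2 ^ 2 * ‖fourierX f.1 p‖ ≤ (4 * Real.pi ^ 2) * (p.2 ^ 2 * ‖fourierX f.1 p‖) :=
    le_mul_of_one_le_left (by positivity) (by nlinarith)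
  nlinarith

/-! ### The operator on Schwartz functions and its transpose -/

theorem integral_strip_dT (f g : Schwartz) :
    ∫ p in strip, (schwartzDT f).1 p * g.1 p = -∫ p in strip, f.1 p * (schwartzDT g).1 p := by
  rw [eq_neg_iff_add_eq_zero, ← integral_add (integrableOn_mul _ _) (integrableOn_mul _ _)]
  refine (integral_strip_swap ((integrableOn_mul (schwartzDT f) g).add
    (integrableOn_mul f (schwartzDT g)))).trans ?_
  refine integral_eq_zero_of_ae (Filter.Eventually.of_forall fun x => ?_)
  have hc : ∀ h : Schwartz, Continuous fun t => h.1 (t, x) := fun h =>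
    h.2.1.continuous.comp (by fun_prop)
  have h := intervalIntegral.integral_eq_sub_of_hasDerivAt (a := 0) (b := 2 * Real.pi)
    (f := fun t => f.1 (t, x) * g.1 (t, x))
    (fun t _ => (hasDerivAt_partialT f.2.1 t x).mul (hasDerivAt_partialT g.2.1 t x))
    ((((hc (schwartzDT f)).mul (hc g)).add
      ((hc f).mul (hc (schwartzDT g)))).intervalIntegrable _ _)
  refine h.trans ?_
  have h1 := f.2.2.1 0 x
  have h2 := g.2.2.1 0 x
  rw [zero_add] at h1 h2
  simp only [h1, h2, sub_self, Pi.zero_apply]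

theorem integral_strip_dX (f g : Schwartz) :
    ∫ p in strip, (schwartzDX f).1 p * g.1 p = -∫ p in strip, f.1 p * (schwartzDX g).1 p := by
  rw [eq_neg_iff_add_eq_zero, ← integral_add (integrableOn_mul _ _) (integrableOn_mul _ _)]
  refine (integral_strip ((integrableOn_mul (schwartzDX f) g).add
    (integrableOn_mul f (schwartzDX g)))).trans ?_
  refine (intervalIntegral.integral_congr fun t _ => ?_).trans intervalIntegral.integral_zero
  exact integral_eq_zero_of_hasDerivAt_of_integrable
    (fun x => (hasDerivAt_partialX f.2.1 t x).mul (hasDerivAt_partialX g.2.1 t x))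
    ((integrable_slice_mul (schwartzDX f) g t).add (integrable_slice_mul f (schwartzDX g) t))
    (integrable_slice_mul f g t)

/-- The operator `∂_t + c(t) ∂_x + q(t)` on Schwartz functions. -/
def schwartzOp (c q : SmoothTorus) : Schwartz →ₗ[ℂ] Schwartz :=
  schwartzDT + schwartzMul c ∘ₗ schwartzDX + schwartzMul q

theorem schwartzOp_apply (c q : SmoothTorus) (f : Schwartz) :
    schwartzOp c q f = schwartzDT f + schwartzMul c (schwartzDX f) + schwartzMul q f := rfl

theorem schwartzDX_schwartzMul (c : SmoothTorus) (f : Schwartz) :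
    schwartzDX (schwartzMul c f) = schwartzMul c (schwartzDX f) :=
  Subtype.ext (partialX_iter_mul (a := c.1) (f := f.1) 1)

theorem schwartzMul_neg (q : SmoothTorus) (f : Schwartz) :
    schwartzMul (-q) f = -schwartzMul q f :=
  Subtype.ext (funext fun p => neg_mul (q.1 p.1) (f.1 p))

/-- Both derivatives change sign under transposition and `c(t)` commutes with `∂_x`, so the
transpose of `L` is `-(∂_t + c ∂_x - q)`. -/
theorem vectorFieldOp_apply (c q : SmoothTorus) (u : Tempered) (g : Schwartz) :
    (vectorFieldOp c q u).1 g = -u.1 (schwartzOp c (-q) g) := by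
  have h : (vectorFieldOp c q u).1 g =
      -u.1 (schwartzDT g) + -u.1 (schwartzDX (schwartzMul c g)) + u.1 (schwartzMul q g) := rfl
  rw [h, schwartzDX_schwartzMul, schwartzOp_apply, schwartzMul_neg, map_add, map_add, map_neg]
  ring

theorem toTempered_apply (g f : Schwartz) : (toTempered g).1 f = ∫ p in strip, g.1 p * f.1 p := rfl

theorem toTempered_comm (f g : Schwartz) : (toTempered f).1 g = (toTempered g).1 f := by
  simp only [toTempered_apply, mul_comm]

theorem toTempered_schwartzOp (c q : SmoothTorus) (v : Schwartz) :
    toTempered (schwartzOp c q v) = vectorFieldOp c q (toTempered v) := by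
  refine Subtype.ext (LinearMap.ext fun g => ?_)
  have h1 : (toTempered g).1 (schwartzDT v) = -(toTempered v).1 (schwartzDT g) := by
    rw [toTempered_comm]
    exact integral_strip_dT v g
  have h2 : (toTempered g).1 (schwartzMul c (schwartzDX v)) =
      -(toTempered v).1 (schwartzMul c (schwartzDX g)) := by
    rw [toTempered_comm, ← schwartzDX_schwartzMul, ← schwartzDX_schwartzMul]
    refine (integral_strip_dX (schwartzMul c v) g).trans ?_
    rw [schwartzDX_schwartzMul]
    congr 2
    funext p
    change c.1 p.1 * v.1 p * _ = v.1 p * (c.1 p.1 * _)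
    ring
  have h3 : (toTempered g).1 (schwartzMul q v) = (toTempered v).1 (schwartzMul q g) := by
    rw [toTempered_comm]
    simp only [toTempered_apply]
    congr 1
    funext p
    change q.1 p.1 * v.1 p * _ = v.1 p * (q.1 p.1 * _)
    ring
  rw [vectorFieldOp_apply, toTempered_comm, schwartzOp_apply, schwartzOp_apply, schwartzMul_neg,
    map_add, map_add, map_add, map_add, map_neg, h1, h2, h3]
  ring

/-- Duality replaces a regularity argument for distributions: surjectivity of `L` supplies a
Schwartz solution, and surjectivity of the transpose makes `L` injective on distributions. -/
theorem isSchwartzGloballyHypoelliptic_of_surjective {c q : SmoothTorus}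
    (h : Function.Surjective (schwartzOp c q)) (h' : Function.Surjective (schwartzOp c (-q))) :
    IsSchwartzGloballyHypoelliptic (vectorFieldOp c q) := by
  rintro u ⟨f, hf⟩
  obtain ⟨v, rfl⟩ := h f
  refine ⟨v, Subtype.ext (LinearMap.ext fun g => ?_)⟩
  obtain ⟨φ, rfl⟩ := h' g
  have := congrArg (fun w : Tempered => w.1 φ) hf
  simp only [toTempered_schwartzOp, vectorFieldOp_apply, neg_inj] at this
  exact this

/-- The operator `∂_t + 2πi c(t) ξ + q(t)`, which is conjugate to `∂_t + c(t) ∂_x + q(t)` by the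
Fourier transform in the second variable. -/
def symbolOp (c q : SmoothTorus) : Schwartz →ₗ[ℂ] Schwartz :=
  schwartzDT + (2 * Real.pi * Complex.I : ℂ) • schwartzMul c ∘ₗ schwartzX + schwartzMul q

theorem symbolOp_apply (c q : SmoothTorus) (f : Schwartz) (p : ℝ × ℝ) :
    (symbolOp c q f).1 p =
      partialT f.1 p + (2 * Real.pi * Complex.I * p.2 * c.1 p.1 + q.1 p.1) * f.1 p := by
  change partialT f.1 p + 2 * Real.pi * Complex.I * (c.1 p.1 * (p.2 * f.1 p)) + q.1 p.1 * f.1 p = _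
  ring

theorem fourier_schwartzOp (c q : SmoothTorus) (f : Schwartz) :
    fourier (schwartzOp c q f) = symbolOp c q (fourier f) := by
  rw [schwartzOp_apply, map_add, map_add, fourier_schwartzDT, fourier_schwartzMul,
    fourier_schwartzMul, fourier_schwartzDX, map_smul]
  rfl

theorem fourier_surjective : Function.Surjective fourier := fun f =>
  ⟨_, fourier_iterate_four f⟩

theorem surjective_schwartzOp {c q : SmoothTorus} (h : Function.Surjective (symbolOp c q)) :
    Function.Surjective (schwartzOp c q) := by
  intro f
  obtain ⟨V, hV⟩ := h (fourier f)
  obtain ⟨v, rfl⟩ := fourier_surjective V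
  exact ⟨v, fourier_injective (by rw [fourier_schwartzOp, hV])⟩

/-! ### Periodic solutions of linear ordinary differential equations -/

/-- The integrating factor gives `(e^P v)' = e^P F`. Integrate over `[t, T]` with `T = t + 2π`,
normalising the factor to `1` at `T`: periodicity leaves `(1 - e^{-I}) v(t)` as boundary term, and
the lower bound on `Re p` makes `Re P + M s` increasing, so the factor is at most `e^{2πM}`. No
upper bound on `Re p` enters, which gives uniformity in `ξ`. -/
theorem norm_periodic_solution_le {v F p P : ℝ → ℂ} {I : ℂ} {M K : ℝ}
    (hv : ∀ t, HasDerivAt v (F t - p t * v t) t) (hper : ∀ t, v (t + 2 * Real.pi) = v t)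
    (hP : ∀ t, HasDerivAt P (p t) t) (hI : ∀ t, P (t + 2 * Real.pi) = P t + I)
    (hM : 0 ≤ M) (hp : ∀ t, -M ≤ (p t).re) (hF : ∀ t, ‖F t‖ ≤ K) (t : ℝ) :
    ‖1 - Complex.exp (-I)‖ * ‖v t‖ ≤ Real.exp (M * (2 * Real.pi)) * K * (2 * Real.pi) := by
  have hmono : Monotone fun s => (P s).re + M * s := by
    refine monotone_of_hasDerivAt_nonneg (f' := fun s => (p s).re + M * 1) (fun s => ?_)
      fun s => by simpa using! by linarith [hp s]
    exact (Complex.reCLM.hasFDerivAt.comp_hasDerivAt s (hP s)).add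
      ((hasDerivAt_id s).const_mul M)
  set T := t + 2 * Real.pi with hT
  have hy : ∀ s, HasDerivAt (fun s => Complex.exp (P s - P T) * v s)
      (Complex.exp (P s - P T) * F s) s := fun s => by
    refine ((((hP s).sub_const (P T)).cexp).mul (hv s)).congr_deriv ?_
    ring
  have hb : ∀ s ∈ Set.Ico t T, ‖Complex.exp (P s - P T) * F s‖ ≤
      Real.exp (M * (2 * Real.pi)) * K := fun s hs => by
    rw [norm_mul, Complex.norm_exp, Complex.sub_re]
    have h1 : (P s).re + M * s ≤ (P T).re + M * T := hmono hs.2.le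
    have h2 : M * (T - s) ≤ M * (2 * Real.pi) :=
      mul_le_mul_of_nonneg_left (by linarith [hs.1]) hM
    exact mul_le_mul (Real.exp_le_exp.2 (by linarith)) (hF s) (norm_nonneg _)
      (Real.exp_pos _).le
  have h := norm_image_sub_le_of_norm_deriv_le_segment' (fun s _ => (hy s).hasDerivWithinAt) hb T
    ⟨by linarith [Real.two_pi_pos], le_rfl⟩
  have e1 : P t - P T = -I := by rw [hT, hI]; ring
  rw [sub_self, Complex.exp_zero, e1, hT, hper, ← sub_mul, norm_mul, add_sub_cancel_left] at h
  exact h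

/-- Time reversal `t ↦ -t` exchanges the two one-sided bounds on `Re p` and replaces `I` by `-I`. -/
theorem norm_periodic_solution_le' {v F p P : ℝ → ℂ} {I : ℂ} {M K : ℝ}
    (hv : ∀ t, HasDerivAt v (F t - p t * v t) t) (hper : ∀ t, v (t + 2 * Real.pi) = v t)
    (hP : ∀ t, HasDerivAt P (p t) t) (hI : ∀ t, P (t + 2 * Real.pi) = P t + I)
    (hM : 0 ≤ M) (hp : ∀ t, (p t).re ≤ M) (hF : ∀ t, ‖F t‖ ≤ K) (t : ℝ) :
    ‖1 - Complex.exp I‖ * ‖v t‖ ≤ Real.exp (M * (2 * Real.pi)) * K * (2 * Real.pi) := by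
  have hneg : ∀ {f : ℝ → ℂ} {f' : ℂ} {t : ℝ}, HasDerivAt f f' (-t) →
      HasDerivAt (fun s => f (-s)) (-f') t := fun {f f' t} h => by
    exact (h.scomp t (hasDerivAt_neg t)).congr_deriv (neg_one_smul ℝ f')
  have h := norm_periodic_solution_le (v := fun s => v (-s)) (F := fun s => -F (-s))
    (p := fun s => -p (-s)) (P := fun s => P (-s)) (I := -I) (K := K)
    (fun s => (hneg (hv (-s))).congr_deriv (by ring))
    (fun s => by rw [← hper (-(s + 2 * Real.pi))]; congr 1; ring)
    (fun s => hneg (hP (-s)))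
    (fun s => by
      have := hI (-(s + 2 * Real.pi))
      rw [show -(s + 2 * Real.pi) + 2 * Real.pi = -s by ring] at this
      rw [this]; ring)
    hM (fun s => by simpa using hp (-s)) (fun s => by simpa using hF (-s)) (-t)
  simpa using h

/-- The primitive of `a` that vanishes at `0`. -/
def primitive (a : ℝ → ℂ) (t : ℝ) : ℂ := ∫ s in (0 : ℝ)..t, a s

theorem hasDerivAt_primitive {a : ℝ → ℂ} (ha : Continuous a) (t : ℝ) :
    HasDerivAt (primitive a) (a t) t :=
  intervalIntegral.integral_hasDerivAt_right (ha.intervalIntegrable _ _)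
    (ha.stronglyMeasurableAtFilter _ _) ha.continuousAt

theorem primitive_zero (a : ℝ → ℂ) : primitive a 0 = 0 := intervalIntegral.integral_same

theorem contDiff_primitive {a : ℝ → ℂ} (ha : ContDiff ℝ ∞ a) : ContDiff ℝ ∞ (primitive a) := by
  refine contDiff_infty_iff_deriv.2
    ⟨fun t => (hasDerivAt_primitive ha.continuous t).differentiableAt, ?_⟩
  rw [show deriv (primitive a) = a from
    funext fun t => (hasDerivAt_primitive ha.continuous t).deriv]
  exact ha

theorem integral_eq_avg (a : SmoothTorus) :
    ∫ t in (0 : ℝ)..(2 * Real.pi), a.1 t = 2 * Real.pi * avg a := by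
  have : (Real.pi : ℂ) ≠ 0 := by exact_mod_cast Real.pi_ne_zero
  rw [avg]
  field_simp

theorem primitive_add_period (a : SmoothTorus) (t : ℝ) :
    primitive a.1 (t + 2 * Real.pi) = primitive a.1 t + 2 * Real.pi * avg a := by
  have hi : ∀ x y, IntervalIntegrable a.1 volume x y := fun x y =>
    a.2.1.continuous.intervalIntegrable x y
  have h := a.2.2.intervalIntegral_add_eq t 0
  rw [zero_add, integral_eq_avg] at h
  rw [← h, primitive, primitive, intervalIntegral.integral_add_adjacent_intervals (hi _ _) (hi _ _)]

theorem exists_norm_le_of_mem_smoothTorus (a : SmoothTorus) : ∃ C : ℝ, 0 ≤ C ∧ ∀ t, ‖a.1 t‖ ≤ C := by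
  obtain ⟨C, hC⟩ :=
    (a.2.2.isBounded_of_continuous Real.two_pi_pos.ne' a.2.1.continuous).exists_norm_le
  exact ⟨C, (norm_nonneg _).trans (hC (a.1 0) ⟨0, rfl⟩), fun t => hC _ ⟨t, rfl⟩⟩

theorem exp_ne_one_of_zeroSet_eq_empty {c₀ q₀ : ℂ} (h : zeroSet c₀ q₀ = ∅) (ξ : ℝ) :
    Complex.exp (2 * Real.pi * (2 * Real.pi * Complex.I * ξ * c₀ + q₀)) ≠ 1 := by
  intro he
  obtain ⟨n, hn⟩ := Complex.exp_eq_one_iff.1 he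
  -- The factor `2π` in the second entry comes from the normalisation `e^{-2πixξ}` of the Fourier
  -- transform.
  refine Set.notMem_empty ((-n, 2 * Real.pi * ξ) : ℤ × ℝ) (h ▸ ?_)
  have hπ : (Real.pi : ℂ) ≠ 0 := by exact_mod_cast Real.pi_ne_zero
  have h2 : 2 * Real.pi * Complex.I * ξ * c₀ + q₀ = n * Complex.I :=
    mul_left_cancel₀ (mul_ne_zero two_ne_zero hπ) (hn.trans (by ring))
  simp only [zeroSet, Set.mem_ofPred_eq]
  push_cast
  linear_combination -Complex.I * h2 + (2 * Real.pi * ξ * c₀ - n) * Complex.I_sq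

/-- The exponential has modulus `exp (2π(2πξ Im c₀ - Re q₀))`. If `Im c₀ ≠ 0`, this tends to `0` as
`ξ Im c₀ → -∞`, and the remaining `ξ` form a compact set. If `Im c₀ = 0` and `Re q₀ ≠ 0`, it is a
constant other than `1`. If both vanish, a nonzero `c₀` would make the exponent vanish for some real
`ξ`, against the hypothesis, so `c₀ = 0` and nothing depends on `ξ`. -/
theorem exists_le_norm_one_sub_exp {c₀ q₀ : ℂ}
    (h : ∀ ξ : ℝ, Complex.exp (2 * Real.pi * (2 * Real.pi * Complex.I * ξ * c₀ + q₀)) ≠ 1) :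
    ∃ δ > 0, ∀ ξ : ℝ, ξ * c₀.im ≤ 0 →
      δ ≤ ‖1 - Complex.exp (-(2 * Real.pi * (2 * Real.pi * Complex.I * ξ * c₀ + q₀)))‖ := by
  set g : ℝ → ℝ := fun ξ =>
    ‖1 - Complex.exp (-(2 * Real.pi * (2 * Real.pi * Complex.I * ξ * c₀ + q₀)))‖ with hg
  have hgc : Continuous g := by fun_prop
  have hpos : ∀ ξ, 0 < g ξ := fun ξ => by
    refine norm_pos_iff.2 (sub_ne_zero.2 fun he => h ξ ?_)
    rw [Complex.exp_neg] at he
    exact inv_eq_one.1 he.symm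
  have hnorm : ∀ ξ : ℝ,
      ‖Complex.exp (-(2 * Real.pi * (2 * Real.pi * Complex.I * ξ * c₀ + q₀)))‖ =
        Real.exp (2 * Real.pi * (2 * Real.pi * (ξ * c₀.im) - q₀.re)) := fun ξ => by
    rw [Complex.norm_exp]
    congr 1
    simp
    ring
  by_cases hb : c₀.im = 0
  · by_cases hr : q₀.re = 0
    · by_cases ha : c₀.re = 0
      · have hc : c₀ = 0 := Complex.ext ha hb
        exact ⟨g 0, hpos 0, fun ξ _ => by simp [hg, hc]⟩
      · refine absurd ?_ (h (-q₀.im / (2 * Real.pi * c₀.re)))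
        have hc : c₀ = c₀.re := Complex.ext rfl (by simp [hb])
        have hq : q₀ = q₀.im * Complex.I := Complex.ext (by simp [hr]) (by simp)
        have ha' : (c₀.re : ℂ) ≠ 0 := by exact_mod_cast ha
        have hπ : (Real.pi : ℂ) ≠ 0 := by exact_mod_cast Real.pi_ne_zero
        have : 2 * Real.pi * Complex.I * ((-q₀.im / (2 * Real.pi * c₀.re) : ℝ) : ℂ) * c₀ + q₀ = 0 := by
          rw [hc, hq]
          push_cast
          simp only [Complex.ofReal_re, Complex.mul_im, Complex.ofReal_im, Complex.I_re,
            Complex.I_im, mul_zero, mul_one, add_zero]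
          field_simp
          ring
        rw [this, mul_zero, Complex.exp_zero]
    · refine ⟨|1 - Real.exp (2 * Real.pi * -q₀.re)|, ?_, fun ξ _ => ?_⟩
      · refine abs_pos.2 (sub_ne_zero.2 fun he => hr ?_)
        have := Real.exp_eq_one_iff _ |>.1 he.symm
        simpa [Real.pi_ne_zero] using this
      · have h1 := abs_norm_sub_norm_le 1
          (Complex.exp (-(2 * Real.pi * (2 * Real.pi * Complex.I * ξ * c₀ + q₀))))
        rw [hnorm, hb, norm_one] at h1
        simpa using h1
  -- At `ξ Im c₀ = R` the modulus is `e^{-1}`. If `R > 0`, the compact set below is empty, hence the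
  -- case distinction.
  · obtain ⟨R, hR⟩ : ∃ R : ℝ, 2 * Real.pi * (2 * Real.pi * R - q₀.re) = -1 :=
      ⟨(-1 / (2 * Real.pi) + q₀.re) / (2 * Real.pi), by field_simp; ring⟩
    have hcomp : IsCompact {ξ : ℝ | R ≤ ξ * c₀.im ∧ ξ * c₀.im ≤ 0} := by
      have : {ξ : ℝ | R ≤ ξ * c₀.im ∧ ξ * c₀.im ≤ 0} =
          (Homeomorph.mulRight₀ c₀.im hb) ⁻¹' Set.Icc R 0 := rfl
      rw [this]
      exact (Homeomorph.isCompact_preimage _).2 isCompact_Icc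
    have hex : ∃ δ > 0, ∀ ξ ∈ {ξ : ℝ | R ≤ ξ * c₀.im ∧ ξ * c₀.im ≤ 0}, δ ≤ g ξ := by
      rcases Set.eq_empty_or_nonempty {ξ : ℝ | R ≤ ξ * c₀.im ∧ ξ * c₀.im ≤ 0} with he | hne
      · exact ⟨1, one_pos, by simp [he]⟩
      · obtain ⟨x, -, hx⟩ := hcomp.exists_isMinOn hne hgc.continuousOn
        exact ⟨g x, hpos x, fun ξ hξ => hx hξ⟩
    obtain ⟨δ, hδ, hδg⟩ := hex
    refine ⟨min δ (1 - Real.exp (-1)), lt_min hδ (by simp), fun ξ hξ => ?_⟩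
    by_cases hξR : R ≤ ξ * c₀.im
    · exact (min_le_left _ _).trans (hδg ξ ⟨hξR, hξ⟩)
    · refine (min_le_right _ _).trans ?_
      have h1 := norm_sub_norm_le 1
          (Complex.exp (-(2 * Real.pi * (2 * Real.pi * Complex.I * ξ * c₀ + q₀))))
      rw [hnorm, norm_one] at h1
      refine le_trans (sub_le_sub_left (Real.exp_le_exp.2 ?_) 1) h1
      rw [← hR]
      have := Real.pi_pos
      gcongr
      exact (not_le.1 hξR).le

theorem im_avg (c : SmoothTorus) :
    2 * Real.pi * (avg c).im = ∫ t in (0 : ℝ)..(2 * Real.pi), (c.1 t).im := by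
  have h := congrArg Complex.im (integral_eq_avg c)
  have h2 : ∫ t in (0 : ℝ)..(2 * Real.pi), (c.1 t).im =
      (∫ t in (0 : ℝ)..(2 * Real.pi), c.1 t).im :=
    Complex.imCLM.intervalIntegral_comp_comm (c.2.1.continuous.intervalIntegrable _ _)
  rw [h2, h]
  simp

theorem mul_im_avg_nonpos {c : SmoothTorus} {ξ : ℝ} (h : ∀ t, ξ * (c.1 t).im ≤ 0) :
    ξ * (avg c).im ≤ 0 := by
  have h1 : 0 ≤ ∫ t in (0 : ℝ)..(2 * Real.pi), -ξ * (c.1 t).im :=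
    intervalIntegral.integral_nonneg Real.two_pi_pos.le fun t _ => by linarith [h t]
  rw [intervalIntegral.integral_const_mul, ← im_avg] at h1
  have h2 : 0 ≤ 2 * Real.pi * (-(ξ * (avg c).im)) := by linarith
  have := nonneg_of_mul_nonneg_right h2 Real.two_pi_pos
  linarith

theorem avg_neg (c : SmoothTorus) : avg (-c) = -avg c := by
  have : ∀ t, (-c).1 t = -c.1 t := fun _ => rfl
  simp only [avg, this, intervalIntegral.integral_neg, mul_neg]

/-- An a priori estimate for periodic solutions, uniform in `ξ`. -/
theorem exists_norm_solution_le {c q : SmoothTorus} (hz : zeroSet (avg c) (avg q) = ∅)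
    (hb : (∀ t : ℝ, 0 ≤ (c.1 t).im) ∨ (∀ t : ℝ, (c.1 t).im ≤ 0)) :
    ∃ C : ℝ, ∀ (ξ : ℝ) (v F : ℝ → ℂ) (K : ℝ),
      (∀ t, HasDerivAt v (F t - (2 * Real.pi * Complex.I * ξ * c.1 t + q.1 t) * v t) t) →
      (∀ t, v (t + 2 * Real.pi) = v t) → (∀ t, ‖F t‖ ≤ K) → ∀ t, ‖v t‖ ≤ C * K := by
  have hne := exp_ne_one_of_zeroSet_eq_empty hz
  obtain ⟨δ, hδ, h1⟩ := exists_le_norm_one_sub_exp hne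
  obtain ⟨δ', hδ', h2⟩ := exists_le_norm_one_sub_exp (c₀ := -avg c) (q₀ := -avg q) fun ξ he =>
    hne ξ (by
      rw [← inv_eq_one, ← Complex.exp_neg, ← he]
      congr 1
      ring)
  obtain ⟨M, hM0, hM⟩ := exists_norm_le_of_mem_smoothTorus q
  set D := Real.exp (M * (2 * Real.pi)) * (2 * Real.pi) with hD
  have hD0 : 0 ≤ D := by positivity
  refine ⟨max (D / δ) (D / δ'), fun ξ v F K hv hper hF t => ?_⟩
  have hK : 0 ≤ K := (norm_nonneg _).trans (hF 0)
  have hP : ∀ t, HasDerivAt (fun t => 2 * Real.pi * Complex.I * ξ * primitive c.1 t +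
      primitive q.1 t) (2 * Real.pi * Complex.I * ξ * c.1 t + q.1 t) t := fun t =>
    ((hasDerivAt_primitive c.2.1.continuous t).const_mul _).add
      (hasDerivAt_primitive q.2.1.continuous t)
  have hI : ∀ t, 2 * Real.pi * Complex.I * ξ * primitive c.1 (t + 2 * Real.pi) +
      primitive q.1 (t + 2 * Real.pi) = 2 * Real.pi * Complex.I * ξ * primitive c.1 t +
      primitive q.1 t + 2 * Real.pi * (2 * Real.pi * Complex.I * ξ * avg c + avg q) := fun t => by
    rw [primitive_add_period, primitive_add_period]
    ring
  have hre : ∀ t, (2 * Real.pi * Complex.I * ξ * c.1 t + q.1 t).re =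
      -(2 * Real.pi * (ξ * (c.1 t).im)) + (q.1 t).re := fun t => by
    simp
    ring
  have hq : ∀ t, |(q.1 t).re| ≤ M := fun t => (Complex.abs_re_le_norm _).trans (hM t)
  -- The only use of the sign of `b`: for fixed `ξ` the term `-2πξ b(t)` has one sign, so the real
  -- part of the coefficient is bounded below by `-M` or above by `M`, with `M` a bound for `q`.
  have hsign : (∀ t, ξ * (c.1 t).im ≤ 0) ∨ (∀ t, 0 ≤ ξ * (c.1 t).im) := by
    rcases hb with hb | hb <;> rcases le_total 0 ξ with hξ | hξ
    · exact Or.inr fun t => mul_nonneg hξ (hb t)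
    · exact Or.inl fun t => mul_nonpos_of_nonpos_of_nonneg hξ (hb t)
    · exact Or.inl fun t => mul_nonpos_of_nonneg_of_nonpos hξ (hb t)
    · exact Or.inr fun t => mul_nonneg_of_nonpos_of_nonpos hξ (hb t)
  rcases hsign with hs | hs
  · have h := norm_periodic_solution_le hv hper hP hI hM0 (fun t => by
      rw [hre]
      nlinarith [Real.pi_pos, hs t, (abs_le.1 (hq t)).1]) hF t
    have h3 := mul_le_mul_of_nonneg_right (h1 ξ (mul_im_avg_nonpos hs)) (norm_nonneg (v t))
    refine le_trans ?_ (mul_le_mul_of_nonneg_right (le_max_left _ _) hK)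
    rw [div_mul_eq_mul_div, le_div_iff₀ hδ, hD]
    linarith
  · have h := norm_periodic_solution_le' hv hper hP hI hM0 (fun t => by
      rw [hre]
      nlinarith [Real.pi_pos, hs t, (abs_le.1 (hq t)).2]) hF t
    have h4 : ξ * (-avg c).im ≤ 0 := by
      rw [← avg_neg]
      refine mul_im_avg_nonpos fun t => ?_
      change ξ * (-c.1 t).im ≤ 0
      simpa using hs t
    have h3 := mul_le_mul_of_nonneg_right (h2 ξ h4) (norm_nonneg (v t))
    have e : -(2 * Real.pi * (2 * Real.pi * Complex.I * ξ * -avg c + -avg q)) =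
        2 * Real.pi * (2 * Real.pi * Complex.I * ξ * avg c + avg q) := by ring
    rw [e] at h3
    refine le_trans ?_ (mul_le_mul_of_nonneg_right (le_max_right _ _) hK)
    rw [div_mul_eq_mul_div, le_div_iff₀ hδ', hD]
    linarith

/-! ### Periodic solutions depending on a parameter -/

/-- The primitive of `G` in the first variable that vanishes for `t = 0`. -/
def primitiveT (G : ℝ × ℝ → ℂ) : ℝ × ℝ → ℂ := fun p => ∫ s in (0 : ℝ)..p.1, G (s, p.2)

theorem continuous_primitiveT {G : ℝ × ℝ → ℂ} (hG : Continuous G) : Continuous (primitiveT G) := by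
  have h := intervalIntegral.continuous_parametric_intervalIntegral_of_continuous (μ := volume)
    (f := fun (p : ℝ × ℝ) s => G (s, p.2)) (s := fun p : ℝ × ℝ => p.1) (a₀ := 0)
    (hG.comp (by fun_prop)) continuous_fst
  exact h

theorem hasDerivAt_primitiveT_fst {G : ℝ × ℝ → ℂ} (hG : Continuous G) (p : ℝ × ℝ) :
    HasDerivAt (fun s => primitiveT G (s, p.2)) (G p) p.1 :=
  hasDerivAt_primitive (a := fun s => G (s, p.2)) (hG.comp (by fun_prop)) p.1

theorem hasDerivAt_primitiveT_snd {G : ℝ × ℝ → ℂ} (hG : ContDiff ℝ ∞ G) (p : ℝ × ℝ) :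
    HasDerivAt (fun y => primitiveT G (p.1, y)) (primitiveT (partialX G) p) p.2 := by
  have hG' := (contDiff_partialX hG).continuous
  obtain ⟨C, hC⟩ := (isCompact_uIcc.prod isCompact_Icc).exists_bound_of_continuousOn
    (s := Set.uIcc 0 p.1 ×ˢ Set.Icc (p.2 - 1) (p.2 + 1)) hG'.continuousOn
  have hs : ∀ {H : ℝ × ℝ → ℂ} (_ : Continuous H) (y : ℝ), Continuous fun s => H (s, y) :=
    fun hH y => hH.comp (by fun_prop)
  refine (intervalIntegral.hasDerivAt_integral_of_dominated_loc_of_deriv_le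
    (s := Set.Icc (p.2 - 1) (p.2 + 1)) (F := fun y s => G (s, y))
    (F' := fun y s => partialX G (s, y)) (bound := fun _ => C)
    (Icc_mem_nhds (by linarith) (by linarith))
    (Filter.Eventually.of_forall fun y => (hs hG.continuous y).aestronglyMeasurable)
    ((hs hG.continuous _).intervalIntegrable _ _) (hs hG' _).aestronglyMeasurable
    (Filter.Eventually.of_forall fun s h y hy => hC (s, y) ⟨Set.uIoc_subset_uIcc h, hy⟩)
    intervalIntegrable_const
    (Filter.Eventually.of_forall fun s _ y _ => hasDerivAt_partialX hG s y)).2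

theorem contDiff_primitiveT {G : ℝ × ℝ → ℂ} (hG : ContDiff ℝ ∞ G) :
    ContDiff ℝ ∞ (primitiveT G) := by
  -- Primitives alone are not closed under `∂_t`, which returns the integrand; so all smooth
  -- functions are added to the family.
  refine contDiff_of_partials_mem
    {f | ContDiff ℝ ∞ f ∨ ∃ G, ContDiff ℝ ∞ G ∧ f = primitiveT G} ?_ ?_ ?_ (Or.inr ⟨G, hG, rfl⟩)
  · rintro f (hf | ⟨G, hG, rfl⟩)
    · exact hf.continuous
    · exact continuous_primitiveT hG.continuous
  · rintro f (hf | ⟨G, hG, rfl⟩)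
    · exact ⟨_, Or.inl (contDiff_partialT hf), fun p => hasDerivAt_partialT hf p.1 p.2⟩
    · exact ⟨G, Or.inl hG, hasDerivAt_primitiveT_fst hG.continuous⟩
  · rintro f (hf | ⟨G, hG, rfl⟩)
    · exact ⟨_, Or.inl (contDiff_partialX hf), fun p => hasDerivAt_partialX hf p.1 p.2⟩
    · exact ⟨_, Or.inr ⟨_, contDiff_partialX hG, rfl⟩, hasDerivAt_primitiveT_snd hG⟩

/-- The coefficient `2πi ξ c(t) + q(t)`. -/
def symbol (c q : ℝ → ℂ) (p : ℝ × ℝ) : ℂ := 2 * Real.pi * Complex.I * p.2 * c p.1 + q p.1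

/-- Variation of constants: `V = e^{-A}(k + J)` with `J` a primitive of `e^A F`. The requirement
`V(2π) = V(0)` forces `k = J(2π) / (e^{A(2π)} - 1)`, which is smooth in `ξ` because the denominator
never vanishes. -/
theorem exists_periodic_solution_of_primitive {a A F : ℝ × ℝ → ℂ} (hA : ContDiff ℝ ∞ A)
    (hAd : ∀ p : ℝ × ℝ, HasDerivAt (fun s => A (s, p.2)) (a p) p.1) (hA0 : ∀ ξ, A (0, ξ) = 0)
    (hA1 : ∀ ξ, Complex.exp (A (2 * Real.pi, ξ)) ≠ 1) (hF : ContDiff ℝ ∞ F)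
    (hap : ∀ t x : ℝ, a (t + 2 * Real.pi, x) = a (t, x))
    (hFp : ∀ t x : ℝ, F (t + 2 * Real.pi, x) = F (t, x)) :
    ∃ V : ℝ × ℝ → ℂ, ContDiff ℝ ∞ V ∧ (∀ t x : ℝ, V (t + 2 * Real.pi, x) = V (t, x)) ∧
      ∀ p : ℝ × ℝ, HasDerivAt (fun s => V (s, p.2)) (F p - a p * V p) p.1 := by
  obtain ⟨J, hJ, hJd, hJ0⟩ : ∃ J : ℝ × ℝ → ℂ, ContDiff ℝ ∞ J ∧
      (∀ p : ℝ × ℝ, HasDerivAt (fun s => J (s, p.2)) (Complex.exp (A p) * F p) p.1) ∧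
      ∀ ξ, J (0, ξ) = 0 :=
    have hG : ContDiff ℝ ∞ fun p => Complex.exp (A p) * F p := hA.cexp.mul hF
    ⟨_, contDiff_primitiveT hG, hasDerivAt_primitiveT_fst hG.continuous,
      fun _ => intervalIntegral.integral_same⟩
  have hA1' : ∀ ξ, Complex.exp (A (2 * Real.pi, ξ)) - 1 ≠ 0 := fun ξ => sub_ne_zero.2 (hA1 ξ)
  obtain ⟨k, hk, hk0⟩ : ∃ k : ℝ → ℂ, ContDiff ℝ ∞ (fun p : ℝ × ℝ => k p.2) ∧
      ∀ ξ, k ξ = J (2 * Real.pi, ξ) / (Complex.exp (A (2 * Real.pi, ξ)) - 1) := by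
    have hc : ContDiff ℝ ∞ fun p : ℝ × ℝ => (2 * Real.pi, p.2) := contDiff_const.prodMk contDiff_snd
    exact ⟨fun ξ => J (2 * Real.pi, ξ) * (Complex.exp (A (2 * Real.pi, ξ)) - 1)⁻¹,
      (hJ.comp hc).mul (((hA.comp hc).cexp.sub contDiff_const).inv fun p => hA1' p.2),
      fun _ => rfl⟩
  obtain ⟨V, hV⟩ : ∃ V : ℝ × ℝ → ℂ, ∀ t ξ, V (t, ξ) = Complex.exp (-A (t, ξ)) * (k ξ + J (t, ξ)) :=
    ⟨fun p => Complex.exp (-A p) * (k p.2 + J p), fun _ _ => rfl⟩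
  have hode : ∀ p : ℝ × ℝ,
      HasDerivAt (fun s => V (s, p.2)) (F p - a p * V p) p.1 := fun ⟨t, ξ⟩ => by
    simp only [hV]
    refine (((hAd (t, ξ)).fun_neg).cexp.fun_mul ((hJd (t, ξ)).const_add (k ξ))).congr_deriv ?_
    have : Complex.exp (-A (t, ξ)) * Complex.exp (A (t, ξ)) = 1 := by
      rw [← Complex.exp_add, neg_add_cancel, Complex.exp_zero]
    linear_combination F (t, ξ) * this
  refine ⟨V, ?_, fun t x => ?_, hode⟩
  · have : V = fun p => Complex.exp (-A p) * (k p.2 + J p) := funext fun p => hV p.1 p.2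
    rw [this]
    exact hA.neg.cexp.mul (hk.add hJ)
  -- The difference `V(· + 2π) - V` solves the homogeneous equation, so its product with `e^A` is
  -- constant; the choice of `k` makes it vanish at `0`.
  · have hD : ∀ s, HasDerivAt
        (fun s => Complex.exp (A (s, x)) * (V (s + 2 * Real.pi, x) - V (s, x))) 0 s := fun s => by
      have h1 := (hode (s + 2 * Real.pi, x)).comp_add_const s (2 * Real.pi)
      refine ((hAd (s, x)).cexp.fun_mul (h1.fun_sub (hode (s, x)))).congr_deriv ?_
      rw [hFp, hap]
      ring
    have hconst := is_const_of_deriv_eq_zero (fun s => (hD s).differentiableAt)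
      (fun s => (hD s).deriv) t 0
    have h0 : V (0 + 2 * Real.pi, x) - V (0, x) = 0 := by
      have h1 := hA1' x
      have he := Complex.exp_ne_zero (A (2 * Real.pi, x))
      simp only [hV, zero_add, hA0, hJ0, hk0, neg_zero, Complex.exp_zero, Complex.exp_neg, one_mul,
        add_zero]
      field_simp
      ring
    simp only [h0, mul_zero] at hconst
    exact sub_eq_zero.1 ((mul_eq_zero.1 hconst).resolve_left (Complex.exp_ne_zero _))

theorem exists_periodic_solution {c q : SmoothTorus} (hz : zeroSet (avg c) (avg q) = ∅)
    {F : ℝ × ℝ → ℂ} (hF : ContDiff ℝ ∞ F) (hFp : ∀ t x : ℝ, F (t + 2 * Real.pi, x) = F (t, x)) :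
    ∃ V : ℝ × ℝ → ℂ, ContDiff ℝ ∞ V ∧ (∀ t x : ℝ, V (t + 2 * Real.pi, x) = V (t, x)) ∧
      ∀ p : ℝ × ℝ, HasDerivAt (fun s => V (s, p.2)) (F p - symbol c.1 q.1 p * V p) p.1 := by
  refine exists_periodic_solution_of_primitive (A := symbol (primitive c.1) (primitive q.1)) ?_
    (fun p => ?_) (fun ξ => ?_) (fun ξ => ?_) hF (fun t x => ?_) hFp
  · have h3 : ContDiff ℝ ∞ fun p : ℝ × ℝ => (p.2 : ℂ) := Complex.ofRealCLM.contDiff.comp contDiff_snd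
    exact ((contDiff_const.mul h3).mul ((contDiff_primitive c.2.1).comp contDiff_fst)).add
      ((contDiff_primitive q.2.1).comp contDiff_fst)
  · exact ((hasDerivAt_primitive c.2.1.continuous p.1).const_mul
      (2 * Real.pi * Complex.I * p.2 : ℂ)).fun_add (hasDerivAt_primitive q.2.1.continuous p.1)
  · simp [symbol, primitive_zero]
  · convert exp_ne_one_of_zeroSet_eq_empty hz ξ using 2
    have e1 := primitive_add_period c 0
    have e2 := primitive_add_period q 0
    rw [zero_add, primitive_zero, zero_add] at e1 e2
    simp only [symbol, e1, e2]
    ring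
  · simp only [symbol, c.2.2 t, q.2.2 t]

/-- For each `ξ`, the function `ξ^γ ∂_ξ^β V` solves the same equation with right-hand side `ξ^γ
∂_ξ^β F - 2πi β c ξ^γ ∂_ξ^{β-1} V`. The uniform a priori estimate and induction on `β` bound it;
powers of `ξ` commute with the equation and cost nothing. -/
theorem rapidlyDecreasing_zero_of_solution {c q : SmoothTorus}
    (hz : zeroSet (avg c) (avg q) = ∅)
    (hb : (∀ t : ℝ, 0 ≤ (c.1 t).im) ∨ (∀ t : ℝ, (c.1 t).im ≤ 0)) (F : Schwartz)
    {V : ℝ × ℝ → ℂ} (hV : ContDiff ℝ ∞ V) (hper : ∀ t x : ℝ, V (t + 2 * Real.pi, x) = V (t, x))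
    (hode : partialT V = F.1 + ((-(2 * Real.pi * Complex.I) : ℂ) • (fun p => c.1 p.1 * mulX V p) +
      (-1 : ℂ) • (fun p => q.1 p.1 * V p))) :
    RapidlyDecreasing 0 V := by
  obtain ⟨C, hC⟩ := exists_norm_solution_le hz hb
  obtain ⟨M, hM0, hM⟩ := exists_norm_le_of_mem_smoothTorus c
  have hperβ : ∀ β, ∀ t x : ℝ, (partialX^[β] V) (t + 2 * Real.pi, x) = (partialX^[β] V) (t, x) := by
    intro β
    induction β with
    | zero => exact hper
    | succ β ih =>
      intro t x
      simp only [Function.iterate_succ_apply', partialX]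
      congr 1
      exact funext fun y => ih t y
  have hodeβ : ∀ β, partialT (partialX^[β] V) = partialX^[β] F.1 +
      ((-(2 * Real.pi * Complex.I) : ℂ) • (fun p => c.1 p.1 * (partialX^[β] (mulX V)) p) +
      (-1 : ℂ) • (fun p => q.1 p.1 * (partialX^[β] V) p)) := fun β => by
    have h1 := contDiff_mulT c.2.1 (contDiff_mulX hV)
    have h2 := contDiff_mulT q.2.1 hV
    rw [← partialX_iter_partialT hV, hode, partialX_iter_add F.2.1
      (contDiff_add_fun (contDiff_smul_const h1 _) (contDiff_smul_const h2 _)),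
      partialX_iter_add (contDiff_smul_const h1 _) (contDiff_smul_const h2 _),
      partialX_iter_smul _ h1, partialX_iter_smul _ h2, partialX_iter_mul, partialX_iter_mul]
  have key : ∀ β γ : ℕ, ∃ B : ℝ, ∀ p, ‖weighted 0 β γ V p‖ ≤ B := by
    intro β
    induction β with
    | zero =>
      intro γ
      refine ⟨C * snorm 0 0 γ F, fun p => ?_⟩
      refine hC p.2 (fun s => weighted 0 0 γ V (s, p.2)) (fun s => weighted 0 0 γ F.1 (s, p.2)) _
        (fun s => ?_) (fun s => ?_) (fun s => le_snorm 0 0 γ F _) p.1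
      · refine ((hasDerivAt_partialT hV s p.2).const_mul ((p.2 : ℂ) ^ γ)).congr_deriv ?_
        rw [hode]
        simp [weighted, mulX]
        ring
      · simp [weighted, hper]
    | succ β ih =>
      intro γ
      obtain ⟨B, hB⟩ := ih γ
      refine ⟨C * (snorm 0 (β + 1) γ F + 2 * Real.pi * (β + 1) * M * B), fun p => ?_⟩
      refine hC p.2 (fun s => weighted 0 (β + 1) γ V (s, p.2))
        (fun s => weighted 0 (β + 1) γ F.1 (s, p.2) +
          -(2 * Real.pi * Complex.I) * (β + 1) * c.1 s * weighted 0 β γ V (s, p.2)) _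
        (fun s => ?_) (fun s => ?_) (fun s => ?_) p.1
      · refine ((hasDerivAt_partialT (contDiff_partialX_iter hV (β + 1)) s p.2).const_mul
          ((p.2 : ℂ) ^ γ)).congr_deriv ?_
        rw [hodeβ, partialX_iter_mulX hV]
        simp only [weighted, Function.iterate_zero, id, mulX, Pi.add_apply, Pi.smul_apply,
          smul_eq_mul]
        ring
      · simp only [weighted, Function.iterate_zero, id, hperβ]
      · refine (norm_add_le _ _).trans (add_le_add (le_snorm 0 (β + 1) γ F _) ?_)
        have e : ‖(β + 1 : ℂ)‖ = β + 1 := by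
          exact_mod_cast Complex.norm_natCast (β + 1)
        simp only [norm_mul, norm_neg, Complex.norm_real, Complex.norm_I, Complex.norm_ofNat,
          mul_one, Real.norm_eq_abs, abs_of_pos Real.pi_pos, e]
        have := Real.pi_pos
        exact mul_le_mul (mul_le_mul_of_nonneg_left (hM s) (by positivity)) (hB _)
          (norm_nonneg _) (by positivity)
  intro α hα β γ
  obtain rfl := Nat.le_zero.1 hα
  exact key β γ

theorem surjective_symbolOp {c q : SmoothTorus} (hz : zeroSet (avg c) (avg q) = ∅)
    (hb : (∀ t : ℝ, 0 ≤ (c.1 t).im) ∨ (∀ t : ℝ, (c.1 t).im ≤ 0)) :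
    Function.Surjective (symbolOp c q) := by
  intro F
  obtain ⟨V, hV, hper, hd⟩ := exists_periodic_solution hz F.2.1 F.2.2.1
  have hT : ∀ p, partialT V p = F.1 p - symbol c.1 q.1 p * V p := fun p => (hd p).deriv
  have hode : partialT V = F.1 + ((-(2 * Real.pi * Complex.I) : ℂ) •
      (fun p => c.1 p.1 * mulX V p) + (-1 : ℂ) • (fun p => q.1 p.1 * V p)) := by
    funext p
    rw [hT]
    simp [symbol, mulX]
    ring
  have hdec : ∀ n, RapidlyDecreasing n V := by
    intro n
    induction n with
    | zero => exact rapidlyDecreasing_zero_of_solution hz hb F hV hper hode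
    | succ n ih =>
      refine ih.succ hV (hode ▸ ?_)
      have h1 := contDiff_mulT c.2.1 (contDiff_mulX hV)
      have h2 := contDiff_mulT q.2.1 hV
      exact ((mem_schwartz_iff.1 F.2).2.2 n).add
        ((((ih.mulX hV).mulT (contDiff_mulX hV) c.2).smul h1 _).add ((ih.mulT hV q.2).smul h2 _)
          (contDiff_smul_const h1 _) (contDiff_smul_const h2 _)) F.2.1
        (contDiff_add_fun (contDiff_smul_const h1 _) (contDiff_smul_const h2 _))
  refine ⟨⟨V, mem_schwartz_iff.2 ⟨hV, hper, hdec⟩⟩, Subtype.ext (funext fun p => ?_)⟩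
  rw [symbolOp_apply, hT, symbol]
  ring

/-- Needed because the transpose carries `-q`. -/
theorem zeroSet_neg {c₀ q₀ : ℂ} (h : zeroSet c₀ q₀ = ∅) : zeroSet c₀ (-q₀) = ∅ := by
  refine Set.eq_empty_of_forall_notMem fun p hp => Set.notMem_empty (-p) (h ▸ ?_)
  simp only [zeroSet, Set.mem_ofPred_eq, Prod.fst_neg, Prod.snd_neg] at hp ⊢
  push_cast
  linear_combination -hp

theorem isSchwartzGloballyHypoelliptic_vectorFieldOp {c q : SmoothTorus}
    (hz : zeroSet (avg c) (avg q) = ∅)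
    (hb : (∀ t : ℝ, 0 ≤ (c.1 t).im) ∨ (∀ t : ℝ, (c.1 t).im ≤ 0)) :
    IsSchwartzGloballyHypoelliptic (vectorFieldOp c q) :=
  isSchwartzGloballyHypoelliptic_of_surjective (surjective_schwartzOp (surjective_symbolOp hz hb))
    (surjective_schwartzOp (surjective_symbolOp (avg_neg q ▸ zeroSet_neg hz) hb))

/-! ### Distributions given by functions on the Fourier side -/

theorem continuous_slice_fst (G : Schwartz) (ξ : ℝ) : Continuous fun t => G.1 (t, ξ) :=
  G.2.1.continuous.comp (by fun_prop)

/-- Integration by parts over a period. The sign of `ξ` in the equation for `w` is opposite to that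
in `symbolOp`, since `w` is paired with the transform of the test function. -/
theorem integral_mul_symbolOp {c q : SmoothTorus} {w f : ℝ → ℂ} {ξ : ℝ}
    (hw : ∀ t, HasDerivAt w (f t + (2 * Real.pi * Complex.I * ξ * c.1 t - q.1 t) * w t) t)
    (hf : Continuous f) (hper : w (2 * Real.pi) = w 0) (G : Schwartz) :
    ∫ t in (0 : ℝ)..(2 * Real.pi), w t * (symbolOp c (-q) G).1 (t, ξ) =
      -∫ t in (0 : ℝ)..(2 * Real.pi), f t * G.1 (t, ξ) := by
  have hwc : Continuous w := continuous_iff_continuousAt.2 fun t => (hw t).continuousAt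
  have i1 : IntervalIntegrable (fun t => w t * (symbolOp c (-q) G).1 (t, ξ)) volume
      0 (2 * Real.pi) :=
    (hwc.mul (continuous_slice_fst (symbolOp c (-q) G) ξ)).intervalIntegrable _ _
  have i2 : IntervalIntegrable (fun t => f t * G.1 (t, ξ)) volume 0 (2 * Real.pi) :=
    (hf.mul (continuous_slice_fst G ξ)).intervalIntegrable _ _
  have h := intervalIntegral.integral_eq_sub_of_hasDerivAt (a := 0) (b := 2 * Real.pi)
    (f := fun t => w t * G.1 (t, ξ))
    (f' := fun t => w t * (symbolOp c (-q) G).1 (t, ξ) + f t * G.1 (t, ξ))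
    (fun t _ => ((hw t).fun_mul (hasDerivAt_partialT G.2.1 t ξ)).congr_deriv (by
      rw [symbolOp_apply]
      change _ = w t * (_ + (_ + -q.1 t) * _) + _
      ring)) (i1.add i2)
  rw [intervalIntegral.integral_add i1 i2] at h
  have hG := G.2.2.1 0 ξ
  rw [zero_add] at hG
  simp only [hper, hG, sub_self] at h
  exact eq_neg_of_add_eq_zero_left h

theorem pNorm_fourier_bound (g : Schwartz) (p : ℝ × ℝ) :
    ‖(fourier g).1 p‖ ≤ 4 * Real.pi * pNorm 4 g := by
  refine (norm_fourier_le_weight g p).trans (mul_le_of_le_one_right ?_ ?_)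
  · have := pNorm_nonneg 4 g
    have := Real.pi_pos
    positivity
  · exact inv_le_one_of_one_le₀ (by nlinarith [sq_nonneg p.2])

/-- The distribution `g ↦ ∫ h(t) ĝ(t, η) dt`. -/
def lineDist (h : SmoothTorus) (η : ℝ) : Tempered :=
  ⟨{ toFun := fun g => ∫ t in (0 : ℝ)..(2 * Real.pi), h.1 t * (fourier g).1 (t, η)
     map_add' := fun f g => by
      have hi : ∀ f : Schwartz, IntervalIntegrable (fun t => h.1 t * (fourier f).1 (t, η)) volume
          0 (2 * Real.pi) := fun f =>
        (h.2.1.continuous.mul (continuous_slice_fst (fourier f) η)).intervalIntegrable _ _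
      rw [← intervalIntegral.integral_add (hi f) (hi g), map_add]
      exact intervalIntegral.integral_congr fun t _ => mul_add _ ((fourier f).1 _) _
     map_smul' := fun a g => by
      rw [RingHom.id_apply, smul_eq_mul, ← intervalIntegral.integral_const_mul, map_smul]
      exact intervalIntegral.integral_congr fun t _ => mul_left_comm _ a _ },
    4, by
      obtain ⟨M, hM0, hM⟩ := exists_norm_le_of_mem_smoothTorus h
      refine ⟨M * (4 * Real.pi) * |2 * Real.pi - 0|, fun g => ?_⟩
      refine (intervalIntegral.norm_integral_le_of_norm_le_const
        (C := M * (4 * Real.pi * pNorm 4 g)) fun t _ => ?_).trans_eq (by ring)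
      rw [norm_mul]
      exact mul_le_mul (hM t) (pNorm_fourier_bound g _) (norm_nonneg _) hM0⟩

theorem lineDist_apply (h : SmoothTorus) (η : ℝ) (g : Schwartz) :
    (lineDist h η).1 g = ∫ t in (0 : ℝ)..(2 * Real.pi), h.1 t * (fourier g).1 (t, η) := rfl

theorem integrableOn_bounded_mul {w : ℝ × ℝ → ℂ} (hw : Continuous w) {B : ℝ}
    (hB : ∀ p, ‖w p‖ ≤ B) (f : Schwartz) : IntegrableOn (fun p => w p * f.1 p) strip :=
  Integrable.bdd_mul (integrableOn_schwartz f) hw.aestronglyMeasurable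
    (Filter.Eventually.of_forall hB)

/-- The distribution `g ↦ ∫ w ĝ`. -/
def fourierDist (w : ℝ × ℝ → ℂ) (hw : Continuous w) (B : ℝ) (hB : ∀ p, ‖w p‖ ≤ B) : Tempered :=
  ⟨{ toFun := fun g => ∫ p in strip, w p * (fourier g).1 p
     map_add' := fun f g => by
      rw [← integral_add (integrableOn_bounded_mul hw hB _) (integrableOn_bounded_mul hw hB _),
        map_add]
      exact integral_congr_ae
        (Filter.Eventually.of_forall fun p => mul_add _ ((fourier f).1 p) _)
     map_smul' := fun a g => by
      rw [RingHom.id_apply, smul_eq_mul, ← integral_const_mul, map_smul]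
      exact integral_congr_ae (Filter.Eventually.of_forall fun p => mul_left_comm _ a _) },
    4, B * (4 * Real.pi) * ∫ p in strip, (1 + p.2 ^ 2)⁻¹, fun g => by
      have e : B * (4 * Real.pi) * (∫ p in strip, (1 + p.2 ^ 2)⁻¹) * pNorm 4 g =
          ∫ p in strip, B * (4 * Real.pi * pNorm 4 g) * (1 + p.2 ^ 2)⁻¹ := by
        rw [integral_const_mul]
        ring
      rw [e]
      refine norm_integral_le_of_norm_le (integrableOn_weight.const_mul _)
        (Filter.Eventually.of_forall fun p => ?_)
      rw [norm_mul, mul_assoc]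
      exact mul_le_mul (hB p) (norm_fourier_le_weight g p) (norm_nonneg _)
        ((norm_nonneg _).trans (hB 0))⟩

theorem fourierDist_apply (w : ℝ × ℝ → ℂ) (hw : Continuous w) (B : ℝ) (hB : ∀ p, ‖w p‖ ≤ B)
    (g : Schwartz) : (fourierDist w hw B hB).1 g = ∫ p in strip, w p * (fourier g).1 p := rfl

theorem toTempered_fourier (f g : Schwartz) :
    (toTempered (fourier f)).1 g = (toTempered f).1 (fourier g) :=
  integral_strip_fourier_mul f g

/-! ### Necessity of the first condition -/

theorem mul_bump_mem_schwartz {w : ℝ × ℝ → ℂ} (hw : ContDiff ℝ ∞ w)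
    (hper : ∀ t x : ℝ, w (t + 2 * Real.pi, x) = w (t, x)) {η : ℝ} (ψ : ContDiffBump η) :
    (fun p : ℝ × ℝ => w p * (ψ p.2 : ℂ)) ∈ Schwartz := by
  refine mem_schwartz_of_support (R := ψ.rOut + |η|) ?_ (fun t x => ?_) fun t x hx => ?_
  · exact hw.mul (Complex.ofRealCLM.contDiff.comp (ψ.contDiff.comp contDiff_snd))
  · simp only [hper]
  · have h1 : ψ.rOut < |x - η| := by linarith [abs_sub_abs_le_abs_sub x η]
    rw [ψ.zero_of_le_dist (by rw [Real.dist_eq]; exact h1.le), Complex.ofReal_zero, mul_zero]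

/-- On the Fourier side the functional lives on the line `ξ = η`, whereas `G` is a bounded function.
Tested on `h⁻¹ ψ` with a bump `ψ` at `η`, the former gives `2π` and the latter tends to `0` with the
width of `ψ`. -/
theorem lineDist_ne_toTempered {h : SmoothTorus} (h0 : ∀ t, h.1 t ≠ 0) (η : ℝ) (g : Schwartz) :
    lineDist h η ≠ toTempered g := by
  intro he
  set G := fourier (fourier (fourier g)) with hG
  have hdual : ∀ H : Schwartz, ∫ t in (0 : ℝ)..(2 * Real.pi), h.1 t * H.1 (t, η) =
      ∫ p in strip, G.1 p * H.1 p := fun H => by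
    -- The third iterate of the transform undoes the one inside `lineDist`; on the other side the
    -- three transforms move onto `g`.
    have := congrArg (fun u : Tempered => u.1 (fourier (fourier (fourier H)))) he
    simp only [lineDist_apply, fourier_iterate_four] at this
    rw [this, ← toTempered_apply, hG, toTempered_fourier, toTempered_fourier, toTempered_fourier]
  have hinv : (fun t => (h.1 t)⁻¹) ∈ SmoothTorus :=
    ⟨h.2.1.inv h0, fun t => by simp only [h.2.2 t]⟩
  obtain ⟨M, hM0, hM⟩ := exists_norm_le_of_mem_smoothTorus ⟨_, hinv⟩
  set K := snorm 0 0 0 G * M with hK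
  have hK0 : 0 ≤ K := mul_nonneg (snorm_nonneg _ _ _ _) hM0
  -- Chosen so that `2rK < 1`.
  set r : ℝ := 1 / (2 * K + 2) with hr
  have hr0 : 0 < r := by positivity
  let ψ : ContDiffBump η := ⟨r / 2, r, by positivity, by linarith⟩
  have hψ0 : ∀ x, r < |x - η| → ψ x = 0 := fun x hx =>
    ψ.zero_of_le_dist (by rw [Real.dist_eq]; exact hx.le)
  have hHs : (fun p : ℝ × ℝ => (h.1 p.1)⁻¹ * (ψ p.2 : ℂ)) ∈ Schwartz :=
    mul_bump_mem_schwartz (w := fun p => (h.1 p.1)⁻¹) (hinv.1.comp contDiff_fst)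
      (fun t x => by simp only [h.2.2 t]) ψ
  have h1 := hdual ⟨_, hHs⟩
  have hψη : ψ η = 1 := ψ.one_of_mem_closedBall (Metric.mem_closedBall_self ψ.rIn_pos.le)
  have h2 : ∫ t in (0 : ℝ)..(2 * Real.pi), h.1 t * ((h.1 t)⁻¹ * (ψ η : ℂ)) = 2 * Real.pi := by
    rw [intervalIntegral.integral_congr (g := fun _ => (1 : ℂ)) fun t _ => by
      simp [hψη, mul_inv_cancel₀ (h0 t)]]
    simp
  have hsl : ∀ t : ℝ, ‖∫ x, G.1 (t, x) * ((h.1 t)⁻¹ * (ψ x : ℂ))‖ ≤ K * (2 * r) := fun t => by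
    rw [← setIntegral_eq_integral_of_forall_compl_eq_zero (s := Set.Icc (η - r) (η + r))]
    · refine (norm_setIntegral_le_of_norm_le_const (C := K) (by simp) fun x _ => ?_).trans_eq ?_
      · have hψ1 : ‖(ψ x : ℂ)‖ ≤ 1 := by
          rw [Complex.norm_real, Real.norm_eq_abs, abs_of_nonneg ψ.nonneg]
          exact ψ.le_one
        rw [norm_mul, norm_mul]
        refine mul_le_mul (norm_le_snorm G _) ?_ (by positivity) (snorm_nonneg _ _ _ _)
        exact (mul_le_of_le_one_right (norm_nonneg _) hψ1).trans (hM t)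
      · rw [Real.volume_real_Icc_of_le (by linarith)]
        ring
    · intro x hx
      have : r < |x - η| := by
        by_contra hlt
        have := abs_le.1 (not_lt.1 hlt)
        exact hx ⟨by linarith, by linarith⟩
      simp [hψ0 x this]
  have h3 : ‖∫ p in strip, G.1 p * ((h.1 p.1)⁻¹ * (ψ p.2 : ℂ))‖ ≤ K * (2 * r) * (2 * Real.pi) := by
    rw [integral_strip (integrableOn_mul G ⟨_, hHs⟩)]
    refine (intervalIntegral.norm_integral_le_of_norm_le_const fun t _ => hsl t).trans_eq ?_
    rw [sub_zero, abs_of_pos Real.two_pi_pos]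
  rw [← h1, h2] at h3
  have h4 : K * (2 * r) < 1 := by
    rw [hr]
    field_simp
    linarith
  have h5 : ‖(2 * Real.pi : ℂ)‖ = 2 * Real.pi := by
    simp [abs_of_pos Real.pi_pos]
  rw [h5] at h3
  nlinarith [Real.two_pi_pos]

theorem zeroSet_eq_empty_of_isSchwartzGloballyHypoelliptic {c q : SmoothTorus}
    (hL : IsSchwartzGloballyHypoelliptic (vectorFieldOp c q)) :
    zeroSet (avg c) (avg q) = ∅ := by
  refine Set.eq_empty_of_forall_notMem fun ⟨k, ξ⟩ hkξ => ?_
  simp only [zeroSet, Set.mem_ofPred_eq] at hkξ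
  -- With this `η`, the relation for `(k, ξ)` says that `E` below increases by exactly `2πik` over a
  -- period, so `exp E` is periodic.
  obtain ⟨η, hη⟩ : ∃ η : ℝ, ξ = -(2 * Real.pi * η) :=
    ⟨-ξ / (2 * Real.pi), by field_simp⟩
  set E : ℝ → ℂ := fun t => 2 * Real.pi * Complex.I * η * primitive c.1 t - primitive q.1 t with hE
  have hEd : ∀ t, HasDerivAt E (2 * Real.pi * Complex.I * η * c.1 t - q.1 t) t := fun t =>
    ((hasDerivAt_primitive c.2.1.continuous t).const_mul
      (2 * Real.pi * Complex.I * η : ℂ)).fun_sub (hasDerivAt_primitive q.2.1.continuous t)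
  have hEs : ContDiff ℝ ∞ E :=
    (contDiff_const.mul (contDiff_primitive c.2.1)).sub (contDiff_primitive q.2.1)
  have hper : ∀ t, Complex.exp (E (t + 2 * Real.pi)) = Complex.exp (E t) := fun t => by
    have : E (t + 2 * Real.pi) = E t + k * (2 * Real.pi * Complex.I) := by
      simp only [hE, primitive_add_period]
      rw [hη] at hkξ
      push_cast at hkξ
      linear_combination (-2 * Real.pi * Complex.I) * hkξ - 2 * Real.pi * avg q * Complex.I_sq
    rw [this, Complex.exp_add, Complex.exp_int_mul_two_pi_mul_I, mul_one]
  let h : SmoothTorus := ⟨fun t => Complex.exp (E t), hEs.cexp, hper⟩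
  have hd : ∀ t, HasDerivAt h.1 (0 + (2 * Real.pi * Complex.I * η * c.1 t - q.1 t) * h.1 t) t :=
    fun t => (hEd t).cexp.congr_deriv (by rw [zero_add, mul_comm])
  have hLu : vectorFieldOp c q (lineDist h η) = toTempered 0 := by
    refine Subtype.ext (LinearMap.ext fun g => ?_)
    rw [vectorFieldOp_apply, lineDist_apply, fourier_schwartzOp,
      integral_mul_symbolOp hd continuous_const (by simpa using hper 0)]
    simp [toTempered_apply]
  obtain ⟨g, hg⟩ := hL _ ⟨0, hLu⟩
  exact lineDist_ne_toTempered (fun t => Complex.exp_ne_zero _) η g hg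

/-! ### Distributions with a smooth symbol -/

/-- Test with the conjugate of `w` times a bump: the integral of a continuous nonnegative function
vanishes. The edge `t = 2π` of the strip is reached by continuity from the interior. -/
theorem eq_zero_of_forall_integral_eq_zero {w : ℝ × ℝ → ℂ} (hw : ContDiff ℝ ∞ w)
    (hper : ∀ t x : ℝ, w (t + 2 * Real.pi, x) = w (t, x))
    (h : ∀ H : Schwartz, ∫ p in strip, w p * H.1 p = 0) : w = 0 := by
  funext ⟨t, x⟩
  obtain ⟨s, hs, hst⟩ := Function.Periodic.exists_mem_Ioc (f := fun t => w (t, x))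
    (fun t => hper t x) Real.two_pi_pos t 0
  rw [zero_add] at hs
  change w (t, x) = 0
  rw [hst]
  let ψ : ContDiffBump x := ⟨1, 2, one_pos, one_lt_two⟩
  have hconj : ContDiff ℝ ∞ fun p => (starRingEnd ℂ) (w p) := Complex.conjCLE.contDiff.comp hw
  have hHs := mul_bump_mem_schwartz hconj (fun t y => by simp only [hper]) ψ
  set N : ℝ × ℝ → ℝ := fun p => Complex.normSq (w p) * ψ p.2 with hN
  have hNe : ∀ p, w p * ((starRingEnd ℂ) (w p) * (ψ p.2 : ℂ)) = (N p : ℂ) := fun p => by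
    rw [← mul_assoc, Complex.mul_conj, hN]
    push_cast
    rfl
  have hNc : Continuous N := (Complex.continuous_normSq.comp hw.continuous).mul
    (ψ.continuous.comp continuous_snd)
  have hint : IntegrableOn N strip := by
    have hNs := mul_bump_mem_schwartz (hw.mul hconj) (fun t y => by simp only [hper]) ψ
    refine (integrableOn_schwartz ⟨_, hNs⟩).re.congr (Filter.Eventually.of_forall fun p => ?_)
    simp only [mul_assoc, hNe]
    exact Complex.ofReal_re _
  have hzero : ∫ p in strip, N p = 0 := by
    have := h ⟨_, hHs⟩
    simp only [hNe] at this
    rw [integral_complex_ofReal] at this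
    exact_mod_cast this
  have hae := (setIntegral_eq_zero_iff_of_nonneg_ae (Filter.Eventually.of_forall fun p =>
    mul_nonneg (Complex.normSq_nonneg _) ψ.nonneg) hint).1 hzero
  have hsub : strip ⊆ closure (interior strip) := by
    rw [strip, interior_prod_eq, interior_Ioc, interior_univ, closure_prod_eq,
      closure_Ioo Real.two_pi_pos.ne, closure_univ]
    exact Set.prod_mono Set.Ioc_subset_Icc_self subset_rfl
  have heq := Measure.eqOn_of_ae_eq hae hNc.continuousOn continuousOn_const hsub
    (⟨hs, trivial⟩ : (s, x) ∈ strip)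
  have hψx : ψ x = 1 := ψ.one_of_mem_closedBall (Metric.mem_closedBall_self ψ.rIn_pos.le)
  simpa [hN, hψx] using heq

/-- Global hypoellipticity read on the Fourier side: `w` defines a distribution `u` with `Lu`
Schwartz, so `u` is Schwartz, and `w` coincides with its inverse transform. Counterexamples can thus
be built as functions of `(t, ξ)`. -/
theorem mem_schwartz_of_isSchwartzGloballyHypoelliptic {c q : SmoothTorus}
    (hL : IsSchwartzGloballyHypoelliptic (vectorFieldOp c q)) {w : ℝ × ℝ → ℂ}
    (hw : ContDiff ℝ ∞ w) (hper : ∀ t x : ℝ, w (t + 2 * Real.pi, x) = w (t, x)) {B : ℝ}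
    (hB : ∀ p, ‖w p‖ ≤ B) (f : Schwartz)
    (hf : ∀ p, partialT w p =
      f.1 p + (2 * Real.pi * Complex.I * p.2 * c.1 p.1 - q.1 p.1) * w p) : w ∈ Schwartz := by
  have hLu : vectorFieldOp c q (fourierDist w hw.continuous B hB) = toTempered (fourier f) := by
    refine Subtype.ext (LinearMap.ext fun g => ?_)
    rw [vectorFieldOp_apply, fourierDist_apply, fourier_schwartzOp, toTempered_fourier,
      toTempered_apply, integral_strip_swap (integrableOn_bounded_mul hw.continuous hB _),
      integral_strip_swap (integrableOn_mul _ _), ← integral_neg]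
    refine integral_congr_ae (Filter.Eventually.of_forall fun ξ => ?_)
    have := integral_mul_symbolOp (c := c) (q := q) (w := fun t => w (t, ξ))
      (f := fun t => f.1 (t, ξ)) (ξ := ξ)
      (fun t => (hasDerivAt_partialT hw t ξ).congr_deriv (hf (t, ξ)))
      (continuous_slice_fst f ξ) (by simpa using hper 0 ξ) (fourier g)
    simp only [this, neg_neg]
  obtain ⟨g, hg⟩ := hL _ ⟨_, hLu⟩
  set G := fourier (fourier (fourier g)) with hG
  suffices h : w - G.1 = 0 by rw [sub_eq_zero.1 h]; exact G.2
  refine eq_zero_of_forall_integral_eq_zero (hw.sub G.2.1)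
    (fun t x => by simp only [Pi.sub_apply, hper, G.2.2.1]) fun H => ?_
  have := congrArg (fun u : Tempered => u.1 (fourier (fourier (fourier H)))) hg
  simp only [fourierDist_apply, fourier_iterate_four] at this
  rw [← toTempered_fourier, ← toTempered_fourier, ← toTempered_fourier, ← hG,
    toTempered_apply] at this
  simp only [Pi.sub_apply, sub_mul]
  rw [integral_sub (integrableOn_bounded_mul hw.continuous hB H) (integrableOn_mul G H), this,
    sub_self]

/-! ### Exponentially decreasing functions -/

/-- A smooth function that vanishes on `(-∞, 0]` and equals `1` on `[1, ∞)`. -/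
def smoothStep (x : ℝ) : ℂ := (Real.smoothTransition x : ℂ)

theorem contDiff_iterate_deriv {g : ℝ → ℂ} (hg : ContDiff ℝ ∞ g) (k : ℕ) :
    ContDiff ℝ ∞ (deriv^[k] g) := by
  induction k with
  | zero => exact hg
  | succ k ih =>
    rw [Function.iterate_succ_apply']
    exact (contDiff_infty_iff_deriv.1 ih).2

theorem contDiff_smoothStep : ContDiff ℝ ∞ smoothStep :=
  Complex.ofRealCLM.contDiff.comp Real.smoothTransition.contDiff

theorem iterate_deriv_eq_of_isOpen {g : ℝ → ℂ} {s : Set ℝ} (hs : IsOpen s) {b : ℂ}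
    (hg : ∀ x ∈ s, g x = b) (k : ℕ) : ∀ x ∈ s, (deriv^[k] g) x = if k = 0 then b else 0 := by
  induction k with
  | zero => simpa using hg
  | succ k ih =>
    intro x hx
    have h : deriv^[k] g =ᶠ[nhds x] fun _ => if k = 0 then b else 0 := by
      filter_upwards [hs.mem_nhds hx] with y hy using ih y hy
    rw [Function.iterate_succ_apply', h.deriv_eq]
    simp

theorem iterate_deriv_smoothStep_of_neg (k : ℕ) {x : ℝ} (hx : x < 0) :
    (deriv^[k] smoothStep) x = 0 := by
  have := iterate_deriv_eq_of_isOpen (g := smoothStep) isOpen_Iio (b := 0) (fun y hy => by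
    simp [smoothStep, Real.smoothTransition.zero_of_nonpos (le_of_lt hy)]) k x hx
  simpa using this

theorem exists_norm_iterate_deriv_smoothStep_le (k : ℕ) :
    ∃ C : ℝ, 0 ≤ C ∧ ∀ x, ‖(deriv^[k] smoothStep) x‖ ≤ C := by
  obtain ⟨C, hC⟩ := (isCompact_Icc (a := (0 : ℝ)) (b := 1)).exists_bound_of_continuousOn
    (contDiff_iterate_deriv contDiff_smoothStep k).continuous.continuousOn
  refine ⟨max C 1, zero_le_one.trans (le_max_right _ _), fun x => ?_⟩
  rcases lt_or_ge x 0 with h0 | h0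
  · simp [iterate_deriv_smoothStep_of_neg k h0]
  rcases le_or_gt x 1 with h1 | h1
  · exact (hC x ⟨h0, h1⟩).trans (le_max_left _ _)
  · rw [iterate_deriv_eq_of_isOpen (g := smoothStep) isOpen_Ioi (b := 1) (fun y hy => by
      simp [smoothStep, Real.smoothTransition.one_of_one_le (le_of_lt hy)]) k x h1]
    refine le_trans ?_ (le_max_right _ _)
    split_ifs <;> simp

theorem pow_mul_exp_le {ε x : ℝ} (hε : 0 < ε) (hx : 0 ≤ x) (n : ℕ) :
    x ^ n * Real.exp (-(ε * x)) ≤ n.factorial / ε ^ n := by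
  have h := Real.pow_div_factorial_le_exp (ε * x) (by positivity) n
  rw [Real.exp_neg, ← div_eq_mul_inv, div_le_div_iff₀ (Real.exp_pos _) (by positivity)]
  rw [div_le_iff₀ (by positivity), mul_pow] at h
  linarith

/-- The function `a(t) g(ξ) e^{ξ z(t)}`. -/
def expFun (a z g : ℝ → ℂ) (p : ℝ × ℝ) : ℂ := a p.1 * (g p.2 * Complex.exp (p.2 * z p.1))

theorem contDiff_expFun {a z g : ℝ → ℂ} (ha : ContDiff ℝ ∞ a) (hz : ContDiff ℝ ∞ z)
    (hg : ContDiff ℝ ∞ g) : ContDiff ℝ ∞ (expFun a z g) :=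
  (ha.comp contDiff_fst).mul ((hg.comp contDiff_snd).mul
    ((Complex.ofRealCLM.contDiff.comp contDiff_snd).mul (hz.comp contDiff_fst)).cexp)

theorem hasDerivAt_of_contDiff {a : ℝ → ℂ} (ha : ContDiff ℝ ∞ a) (t : ℝ) :
    HasDerivAt a (deriv a t) t :=
  (ha.differentiable (by simp) t).hasDerivAt

theorem partialT_expFun {a z : ℝ → ℂ} (g : ℝ → ℂ) (ha : ContDiff ℝ ∞ a) (hz : ContDiff ℝ ∞ z) :
    partialT (expFun a z g) =
      expFun (deriv a) z g + mulX (expFun (fun t => a t * deriv z t) z g) := by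
  funext ⟨t, x⟩
  have h := (hasDerivAt_of_contDiff ha t).fun_mul
    ((((hasDerivAt_of_contDiff hz t).const_mul (x : ℂ)).cexp).const_mul (g x))
  refine h.deriv.trans ?_
  simp only [expFun, mulX, Pi.add_apply]
  ring

theorem partialX_expFun (a z : ℝ → ℂ) {g : ℝ → ℂ} (hg : ContDiff ℝ ∞ g) :
    partialX (expFun a z g) = expFun a z (deriv g) + expFun (fun t => a t * z t) z g := by
  funext ⟨t, x⟩
  have h := ((hasDerivAt_of_contDiff hg x).fun_mul
    ((Complex.ofRealCLM.hasDerivAt (x := x)).mul_const (z t)).cexp).const_mul (a t)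
  refine h.deriv.trans ?_
  simp only [expFun, Pi.add_apply, Complex.ofRealCLM_apply, Complex.ofReal_one]
  ring

theorem deriv_mem_smoothTorus {a : ℝ → ℂ} (ha : a ∈ SmoothTorus) : deriv a ∈ SmoothTorus :=
  ⟨(contDiff_infty_iff_deriv.1 ha.1).2, fun t => by
    rw [← deriv_comp_add_const]
    congr 1
    exact funext ha.2⟩

theorem mul_mem_smoothTorus {a b : ℝ → ℂ} (ha : a ∈ SmoothTorus) (hb : b ∈ SmoothTorus) :
    (fun t => a t * b t) ∈ SmoothTorus :=
  ⟨ha.1.mul hb.1, fun t => by simp only [ha.2 t, hb.2 t]⟩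

/-- The function `a` vanishes on the open set `{Re z > ε}`, hence so does its derivative. -/
theorem re_le_of_deriv_ne_zero {a z : ℝ → ℂ} (hz : Continuous z) {ε : ℝ}
    (h : ∀ t, a t ≠ 0 → (z t).re ≤ ε) (t : ℝ) (ht : deriv a t ≠ 0) : (z t).re ≤ ε := by
  by_contra hlt
  refine ht ?_
  have : a =ᶠ[nhds t] fun _ => 0 := by
    filter_upwards [(isOpen_lt continuous_const (Complex.continuous_re.comp hz)).mem_nhds
      (not_le.1 hlt)] with s hs
    by_contra has
    exact absurd (h s has) (not_le.2 hs)
  simp [this.deriv_eq]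

/-- Derivatives of such a function are sums of functions of the same type, with amplitudes still
vanishing wherever `Re z > -ε` and possibly a factor `x`. Each is dominated by a multiple of `x^γ
e^{-εx}` on `x ≥ 0`, and the step kills `x < 0`. -/
theorem expFun_mem_schwartz {a z : ℝ → ℂ} (ha : a ∈ SmoothTorus) (hz : z ∈ SmoothTorus) {ε : ℝ}
    (hε : 0 < ε) (h : ∀ t, a t ≠ 0 → (z t).re ≤ -ε) : expFun a z smoothStep ∈ Schwartz := by
  have hg := contDiff_iterate_deriv contDiff_smoothStep
  let S : Set (ℝ → ℂ) := {a | a ∈ SmoothTorus ∧ ∀ t, a t ≠ 0 → (z t).re ≤ -ε}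
  have hmul : ∀ a ∈ S, ∀ b ∈ SmoothTorus, (fun t => a t * b t) ∈ S := fun a ha b hb =>
    ⟨mul_mem_smoothTorus ha.1 hb, fun t ht => ha.2 t (left_ne_zero_of_mul ht)⟩
  have hderiv : ∀ a ∈ S, deriv a ∈ S := fun a ha =>
    ⟨deriv_mem_smoothTorus ha.1, re_le_of_deriv_ne_zero hz.1.continuous ha.2⟩
  have hs : ∀ a ∈ S, ∀ k, ContDiff ℝ ∞ (expFun a z (deriv^[k] smoothStep)) := fun a ha k =>
    contDiff_expFun ha.1.1 hz.1 (hg k)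
  have h0 : ∀ β, ∀ a ∈ S, ∀ k γ, ∃ C : ℝ, ∀ p,
      ‖weighted 0 β γ (expFun a z (deriv^[k] smoothStep)) p‖ ≤ C := by
    intro β
    induction β with
    | zero =>
      intro a ha k γ
      obtain ⟨M, hM0, hM⟩ := exists_norm_le_of_mem_smoothTorus ⟨a, ha.1⟩
      obtain ⟨C, hC0, hC⟩ := exists_norm_iterate_deriv_smoothStep_le k
      refine ⟨M * C * (γ.factorial / ε ^ γ), fun ⟨t, x⟩ => ?_⟩
      have hB : 0 ≤ M * C * (γ.factorial / ε ^ γ) := by positivity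
      simp only [weighted, Function.iterate_zero, id, expFun]
      rcases lt_or_ge x 0 with hx | hx
      · rw [iterate_deriv_smoothStep_of_neg k hx]
        simpa using hB
      by_cases hat : a t = 0
      · rw [hat]
        simpa using hB
      have hz' : x * (z t).re ≤ -(ε * x) := by nlinarith [ha.2 t hat]
      have he : ‖Complex.exp (x * z t)‖ ≤ Real.exp (-(ε * x)) := by
        rw [Complex.norm_exp, Complex.re_ofReal_mul]
        exact Real.exp_le_exp.2 hz'
      rw [norm_mul, norm_mul, norm_mul, norm_pow, Complex.norm_real, Real.norm_eq_abs,
        abs_of_nonneg hx]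
      calc _ = ‖a t‖ * ‖(deriv^[k] smoothStep) x‖ * (x ^ γ * ‖Complex.exp (x * z t)‖) := by ring
        _ ≤ M * C * (x ^ γ * Real.exp (-(ε * x))) := by
          have := hM t
          have := hC x
          gcongr
        _ ≤ _ := mul_le_mul_of_nonneg_left (pow_mul_exp_le hε hx γ) (by positivity)
    | succ β ih =>
      intro a ha k γ
      obtain ⟨C, hC⟩ := ih a ha (k + 1) γ
      obtain ⟨D, hD⟩ := ih _ (hmul a ha z hz) k γ
      refine ⟨C + D, fun p => ?_⟩
      rw [← weighted_partialX, partialX_expFun a z (hg k),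
        ← Function.iterate_succ_apply' deriv k smoothStep, weighted_add 0 β γ (hs a ha (k + 1))
        (hs _ (hmul a ha z hz) k)]
      exact (norm_add_le _ _).trans (add_le_add (hC p) (hD p))
  have hn : ∀ n, ∀ a ∈ S, RapidlyDecreasing n (expFun a z smoothStep) := by
    intro n
    induction n with
    | zero =>
      intro a ha α hα β γ
      obtain rfl := Nat.le_zero.1 hα
      exact h0 β a ha 0 γ
    | succ n ih =>
      intro a ha
      refine (ih a ha).succ (hs a ha 0) ?_
      have hm := hmul a ha _ (deriv_mem_smoothTorus hz)
      rw [partialT_expFun _ ha.1.1 hz.1]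
      exact (ih _ (hderiv a ha)).add ((ih _ hm).mulX (hs _ hm 0)) (hs _ (hderiv a ha) 0)
        (contDiff_mulX (hs _ hm 0))
  refine mem_schwartz_iff.2 ⟨hs a ⟨ha, h⟩ 0, fun t x => ?_, fun n => hn n a ⟨ha, h⟩⟩
  simp only [expFun, ha.2 t, hz.2 t]

/-- The function `w = φ e^{-Q} smoothStep(ξ) e^{ξz}` is bounded and solves the equation up to the
term with `φ'`, which is Schwartz because `Re z ≤ -ε` there. At `t₀` it equals a nonzero constant
for all `ξ ≥ 1`, so it does not decay. -/
theorem not_isSchwartzGloballyHypoelliptic_of_cutoff {c q φ z Q : SmoothTorus} {ε t₀ : ℝ}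
    (hε : 0 < ε) (hφ : ∀ t, φ.1 t ≠ 0 → (z.1 t).re ≤ 0)
    (hφ' : ∀ t, deriv φ.1 t ≠ 0 → (z.1 t).re ≤ -ε) (hφ₀ : φ.1 t₀ ≠ 0) (hz₀ : z.1 t₀ = 0)
    (hz : ∀ t, φ.1 t * deriv z.1 t = φ.1 t * (2 * Real.pi * Complex.I * c.1 t))
    (hQ : ∀ t, φ.1 t * deriv Q.1 t = φ.1 t * q.1 t) :
    ¬ IsSchwartzGloballyHypoelliptic (vectorFieldOp c q) := by
  intro hL
  have hE : (fun t => Complex.exp (-Q.1 t)) ∈ SmoothTorus :=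
    ⟨Q.2.1.neg.cexp, fun t => by simp only [Q.2.2 t]⟩
  have ha := mul_mem_smoothTorus φ.2 hE
  obtain ⟨M, hM0, hM⟩ := exists_norm_le_of_mem_smoothTorus ⟨_, ha⟩
  set a : ℝ → ℂ := fun t => φ.1 t * Complex.exp (-Q.1 t) with had
  have hw : ContDiff ℝ ∞ (expFun a z.1 smoothStep) :=
    contDiff_expFun ha.1 z.2.1 contDiff_smoothStep
  have hf := expFun_mem_schwartz (mul_mem_smoothTorus (deriv_mem_smoothTorus φ.2) hE) z.2 hε
    fun t ht => hφ' t (left_ne_zero_of_mul ht)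
  have hB : ∀ p, ‖expFun a z.1 smoothStep p‖ ≤ M := fun ⟨t, x⟩ => by
    simp only [expFun]
    rcases lt_or_ge x 0 with hx | hx
    · simpa [smoothStep, Real.smoothTransition.zero_of_nonpos hx.le] using hM0
    by_cases hφt : φ.1 t = 0
    · simpa [had, hφt] using hM0
    rw [norm_mul]
    refine (mul_le_of_le_one_right (norm_nonneg _) ?_).trans (hM t)
    rw [norm_mul, Complex.norm_exp, Complex.re_ofReal_mul, smoothStep, Complex.norm_real,
      Real.norm_eq_abs, abs_of_nonneg (Real.smoothTransition.nonneg x)]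
    exact mul_le_one₀ (Real.smoothTransition.le_one x) (Real.exp_pos _).le
      (Real.exp_le_one_iff.2 (mul_nonpos_of_nonneg_of_nonpos hx (hφ t hφt)))
  have hS := mem_schwartz_of_isSchwartzGloballyHypoelliptic hL hw
    (fun t x => by simp only [expFun, ha.2 t, z.2.2 t]) hB ⟨_, hf⟩ fun ⟨t, x⟩ => by
      rw [partialT_expFun smoothStep ha.1 z.2.1]
      have hda : deriv a t = deriv φ.1 t * Complex.exp (-Q.1 t) +
          φ.1 t * (Complex.exp (-Q.1 t) * -deriv Q.1 t) :=
        ((hasDerivAt_of_contDiff φ.2.1 t).fun_mul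
          (hasDerivAt_of_contDiff Q.2.1 t).fun_neg.cexp).deriv
      simp only [expFun, mulX, Pi.add_apply, hda]
      simp only [had]
      linear_combination (smoothStep x * Complex.exp (x * z.1 t) * Complex.exp (-Q.1 t)) *
        (x * hz t - hQ t)
  obtain ⟨C, hC⟩ := (mem_schwartz_iff.1 hS).2.2 0 0 le_rfl 0 1
  have hpos : 0 < ‖a t₀‖ := norm_pos_iff.2 (mul_ne_zero hφ₀ (Complex.exp_ne_zero _))
  have h1 : ∀ x : ℝ, 1 ≤ x → x * ‖a t₀‖ ≤ C := fun x hx => by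
    have := hC (t₀, x)
    simpa [weighted, expFun, hz₀, smoothStep, Real.smoothTransition.one_of_one_le hx,
      abs_of_nonneg (zero_le_one.trans hx)] using this
  have h2 := h1 (max 1 (C / ‖a t₀‖ + 1)) (le_max_left _ _)
  have h3 := mul_le_mul_of_nonneg_right (le_max_right 1 (C / ‖a t₀‖ + 1)) hpos.le
  rw [add_mul, div_mul_cancel₀ _ hpos.ne'] at h3
  linarith

/-! ### Necessity of the second condition -/

theorem smoothTransition_cos_mem_smoothTorus (A B m : ℝ) :
    (fun t => (Real.smoothTransition (A * Real.cos (t - m) + B) : ℂ)) ∈ SmoothTorus := by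
  refine ⟨Complex.ofRealCLM.contDiff.comp (Real.smoothTransition.contDiff.comp
    ((contDiff_const.mul (Real.contDiff_cos.comp (contDiff_id.sub contDiff_const))).add
      contDiff_const)), fun t => ?_⟩
  simp only [show t + 2 * Real.pi - m = t - m + 2 * Real.pi by ring, Real.cos_add_two_pi]

theorem deriv_smoothTransition_eq_zero {y : ℝ} (h : y < 0 ∨ 1 < y) {u : ℝ → ℝ} {t : ℝ}
    (hu : ContinuousAt u t) (hy : u t = y) :
    deriv (fun t => (Real.smoothTransition (u t) : ℂ)) t = 0 := by
  subst hy
  rcases h with h | h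
  · have : (fun t => (Real.smoothTransition (u t) : ℂ)) =ᶠ[nhds t] fun _ => 0 := by
      filter_upwards [hu.eventually_lt_const h] with s hs
      simp [Real.smoothTransition.zero_of_nonpos hs.le]
    simp [this.deriv_eq]
  · have : (fun t => (Real.smoothTransition (u t) : ℂ)) =ᶠ[nhds t] fun _ => 1 := by
      filter_upwards [hu.eventually_const_lt h] with s hs
      simp [Real.smoothTransition.one_of_one_le hs.le]
    simp [this.deriv_eq]

theorem cos_lt_cos_of_lt_abs {r s : ℝ} (hr : 0 ≤ r) (hs : |s| ≤ Real.pi) (h : r < |s|) :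
    Real.cos s < Real.cos r := by
  rw [← Real.cos_abs s]
  exact Real.cos_lt_cos_of_nonneg_of_le_pi hr hs h

/-- The condition `cos r ≤ cos (t - m)` is a periodic description of the arc of half-width `r` about
`m`; this returns to the interval itself. -/
theorem exists_add_period_abs_le {r m t : ℝ} (hr : 0 ≤ r) (ht : Real.cos r ≤ Real.cos (t - m)) :
    ∃ n : ℤ, |t - n * (2 * Real.pi) - m| ≤ r := by
  refine ⟨toIocDiv Real.two_pi_pos (m - Real.pi) t, ?_⟩
  have h := toIocMod_mem_Ioc Real.two_pi_pos (m - Real.pi) t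
  have e : toIocMod Real.two_pi_pos (m - Real.pi) t =
      t - toIocDiv Real.two_pi_pos (m - Real.pi) t * (2 * Real.pi) := by
    rw [toIocMod, zsmul_eq_mul]
  rw [e] at h
  by_contra hlt
  refine absurd (cos_lt_cos_of_lt_abs hr (abs_le.2 ⟨by linarith [h.1], by linarith [h.2]⟩)
    (not_le.1 hlt)) (not_lt.2 ?_)
  rwa [show t - (toIocDiv Real.two_pi_pos (m - Real.pi) t : ℝ) * (2 * Real.pi) - m =
    t - m - toIocDiv Real.two_pi_pos (m - Real.pi) t * (2 * Real.pi) by ring,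
    Real.cos_sub_int_mul_two_pi]

theorem exists_lt_of_deriv_neg {f : ℝ → ℝ} {f' a b : ℝ} (hab : a < b) (hf : HasDerivAt f f' a)
    (h : f' < 0) : ∃ s ∈ Set.Ioo a b, f s < f a := by
  have h1 : ∀ᶠ s in nhdsWithin a (Set.Ioi a), slope f a s < 0 :=
    ((hasDerivAt_iff_tendsto_slope.1 hf).mono_left
      (nhdsWithin_mono a fun s hs => ne_of_gt hs)).eventually_lt_const h
  obtain ⟨s, hs, hs'⟩ := (h1.and (Ioo_mem_nhdsGT hab)).exists
  refine ⟨s, hs', ?_⟩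
  rw [slope_def_field, div_lt_iff₀ (by linarith [hs'.1]), zero_mul] at hs
  linarith

theorem exists_lt_of_deriv_pos {f : ℝ → ℝ} {f' a b : ℝ} (hab : a < b) (hf : HasDerivAt f f' b)
    (h : 0 < f') : ∃ s ∈ Set.Ioo a b, f s < f b := by
  have h1 : ∀ᶠ s in nhdsWithin b (Set.Iio b), 0 < slope f b s :=
    ((hasDerivAt_iff_tendsto_slope.1 hf).mono_left
      (nhdsWithin_mono b fun s hs => ne_of_lt hs)).eventually_const_lt h
  obtain ⟨s, hs, hs'⟩ := (h1.and (Ioo_mem_nhdsLT hab)).exists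
  refine ⟨s, hs', ?_⟩
  rw [slope_def_field, lt_div_iff_of_neg (by linarith [hs'.2]), zero_mul] at hs
  linarith

theorem primitive_mem_smoothTorus {a : SmoothTorus} (h : avg a = 0) :
    primitive a.1 ∈ SmoothTorus :=
  ⟨contDiff_primitive a.2.1, fun t => by rw [primitive_add_period, h, mul_zero, add_zero]⟩

theorem avg_sub_smul (a κ : SmoothTorus) (k : ℂ) : avg (a - k • κ) = avg a - k * avg κ := by
  have e : ∀ t, (a - k • κ).1 t = a.1 t - k * κ.1 t := fun _ => rfl
  simp only [avg, e]
  rw [intervalIntegral.integral_sub (a.2.1.continuous.intervalIntegrable _ _)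
    ((κ.2.1.continuous.intervalIntegrable _ _).const_mul k), intervalIntegral.integral_const_mul]
  ring

theorem avg_smoothTransition_ne_zero {κ : SmoothTorus} {g : ℝ → ℝ} (hg : ∀ t, κ.1 t = g t)
    (h0 : ∀ t, 0 ≤ g t) {t : ℝ} (ht : g t ≠ 0) : avg κ ≠ 0 := by
  intro havg
  have hgc : Continuous g := by
    have : g = fun t => (κ.1 t).re := funext fun t => by simp [hg]
    rw [this]
    exact Complex.continuous_re.comp κ.2.1.continuous
  have hgp : Function.Periodic g (2 * Real.pi) := fun t => by
    have := κ.2.2 t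
    rw [hg, hg] at this
    exact_mod_cast this
  obtain ⟨s, hs, hst⟩ := hgp.exists_mem_Ico₀ Real.two_pi_pos t
  have h1 := integral_eq_avg κ
  rw [havg, mul_zero] at h1
  simp only [hg, intervalIntegral.integral_ofReal] at h1
  have h2 : ∫ t in (0 : ℝ)..(2 * Real.pi), g t = 0 := by exact_mod_cast h1
  have h3 := intervalIntegral.integral_pos Real.two_pi_pos hgc.continuousOn (fun t _ => h0 t)
    ⟨s, Set.Ico_subset_Icc_self hs, lt_of_le_of_ne (h0 s) (hst ▸ ht.symm)⟩
  exact h3.ne' h2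

/-- If a continuous function is larger at the end points of an interval than at an interior point,
then it is larger than its minimum, by a fixed amount, near the end points. -/
theorem exists_gap {f : ℝ → ℝ} (hf : Continuous f) {m r : ℝ} (hr : 0 ≤ r) (hrπ : r ≤ Real.pi)
    (h1 : ∃ s, |s - m| ≤ r ∧ f s < f (m - r)) (h2 : ∃ s, |s - m| ≤ r ∧ f s < f (m + r)) :
    ∃ t₀ ε η : ℝ, 0 < ε ∧ 0 < η ∧ Real.cos r + η ≤ Real.cos (t₀ - m) ∧
      (∀ t, |t - m| ≤ r → f t₀ ≤ f t) ∧
      ∀ t, |t - m| ≤ r → Real.cos (t - m) < Real.cos r + η → f t₀ + ε ≤ f t := by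
  have hK : IsCompact {t : ℝ | |t - m| ≤ r} := by
    have : {t : ℝ | |t - m| ≤ r} = Metric.closedBall m r := rfl
    rw [this]
    exact isCompact_closedBall m r
  obtain ⟨t₀, ht₀, hmin⟩ := hK.exists_isMinOn ⟨m, by simpa using hr⟩ hf.continuousOn
  have hmin' : ∀ t, |t - m| ≤ r → f t₀ ≤ f t := fun t ht => hmin ht
  obtain ⟨s₁, hs₁, hs₁'⟩ := h1
  obtain ⟨s₂, hs₂, hs₂'⟩ := h2
  obtain ⟨ε, hε, hε1, hε2⟩ : ∃ ε > 0, f t₀ + ε < f (m - r) ∧ f t₀ + ε < f (m + r) := by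
    have a1 := hmin' s₁ hs₁
    have a2 := hmin' s₂ hs₂
    refine ⟨min (f (m - r) - f t₀) (f (m + r) - f t₀) / 2,
      half_pos (lt_min (by linarith) (by linarith)), ?_, ?_⟩
    · linarith [min_le_left (f (m - r) - f t₀) (f (m + r) - f t₀)]
    · linarith [min_le_right (f (m - r) - f t₀) (f (m + r) - f t₀)]
  have hS : IsCompact ({t : ℝ | |t - m| ≤ r} ∩ {t | f t ≤ f t₀ + ε}) :=
    hK.inter_right (isClosed_le hf continuous_const)
  -- The point `s` of the sublevel set is the farthest from `m`. It cannot be an end point, since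
  -- `f` is too large there; the room left between `s` and the ends defines `η`.
  obtain ⟨s, hs, hsmin⟩ := hS.exists_isMinOn (f := fun t => Real.cos (t - m))
    ⟨t₀, ht₀, by change f t₀ ≤ _; linarith⟩ (by fun_prop)
  have hsr : |s - m| < r := by
    refine lt_of_le_of_ne hs.1 fun he => ?_
    have hs2 : f s ≤ f t₀ + ε := hs.2
    rcases abs_choice (s - m) with h | h
    · rw [show s = m + r by linarith] at hs2
      linarith
    · rw [show s = m - r by linarith] at hs2
      linarith
  refine ⟨t₀, ε, Real.cos (s - m) - Real.cos r, hε, sub_pos.2 ?_, ?_, hmin', fun t ht hlt => ?_⟩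
  · rw [← Real.cos_abs (s - m)]
    exact Real.cos_lt_cos_of_nonneg_of_le_pi (abs_nonneg _) hrπ hsr
  · rw [add_sub_cancel]
    exact hsmin ⟨ht₀, by change f t₀ ≤ _; linarith⟩
  · by_contra hlt'
    rw [add_sub_cancel] at hlt
    have : Real.cos (s - m) ≤ Real.cos (t - m) := hsmin ⟨ht, (not_le.1 hlt').le⟩
    linarith

theorem not_isSchwartzGloballyHypoelliptic_of_sign_change {c q : SmoothTorus} {m r : ℝ}
    (hr : 0 < r) (hrπ : r < Real.pi) (h1 : (c.1 (m - r)).im < 0) (h2 : 0 < (c.1 (m + r)).im) :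
    ¬ IsSchwartzGloballyHypoelliptic (vectorFieldOp c q) := by
  -- A bump living off the arc. Subtracting a multiple of `κ` removes the mean of a coefficient, so
  -- it acquires a periodic primitive, without changing it on the arc.
  obtain ⟨κ, hκ⟩ : ∃ κ : SmoothTorus, ∀ t, κ.1 t =
      (Real.smoothTransition (-1 * Real.cos (t - m) + Real.cos r) : ℂ) :=
    ⟨⟨_, smoothTransition_cos_mem_smoothTorus (-1) (Real.cos r) m⟩, fun _ => rfl⟩
  have hκ0 : ∀ t, Real.cos r ≤ Real.cos (t - m) → κ.1 t = 0 := fun t ht => by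
    rw [hκ, Real.smoothTransition.zero_of_nonpos (by linarith), Complex.ofReal_zero]
  have hκavg : avg κ ≠ 0 := by
    refine avg_smoothTransition_ne_zero hκ (fun t => Real.smoothTransition.nonneg _)
      (t := m + Real.pi) (Real.smoothTransition.pos_of_pos ?_).ne'
    have := Real.cos_lt_cos_of_nonneg_of_le_pi hr.le le_rfl hrπ
    rw [add_sub_cancel_left]
    linarith [Real.cos_pi]
  have hprim : ∀ a : SmoothTorus, ∃ A : SmoothTorus, ∀ t,
      ∃ d, HasDerivAt A.1 d t ∧ (Real.cos r ≤ Real.cos (t - m) → d = a.1 t) := fun a => by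
    have havg : avg (a - (avg a / avg κ) • κ) = 0 := by
      rw [avg_sub_smul, div_mul_cancel₀ _ hκavg, sub_self]
    refine ⟨⟨_, primitive_mem_smoothTorus havg⟩, fun t =>
      ⟨_, hasDerivAt_primitive (a - (avg a / avg κ) • κ).2.1.continuous t, fun ht => ?_⟩⟩
    change a.1 t - (avg a / avg κ) * κ.1 t = a.1 t
    rw [hκ0 t ht, mul_zero, sub_zero]
  obtain ⟨A, hA⟩ := hprim c
  obtain ⟨Q, hQ⟩ := hprim q
  have him : ∀ t, Real.cos r ≤ Real.cos (t - m) →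
      HasDerivAt (fun t => (A.1 t).im) (c.1 t).im t := fun t ht => by
    obtain ⟨d, hd, he⟩ := hA t
    rw [← he ht]
    exact Complex.imCLM.hasFDerivAt.comp_hasDerivAt t hd
  have himc : Continuous fun t => (A.1 t).im := Complex.continuous_im.comp A.2.1.continuous
  obtain ⟨t₀, ε, η, hε, hη, ht₀, hmin, hgap⟩ := exists_gap himc hr.le hrπ.le (m := m)
    (by
      obtain ⟨s, hs, hs'⟩ := exists_lt_of_deriv_neg (a := m - r) (b := m + r) (by linarith)
        (him _ (by simp)) h1
      exact ⟨s, abs_le.2 ⟨by linarith [hs.1], by linarith [hs.2]⟩, hs'⟩)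
    (by
      obtain ⟨s, hs, hs'⟩ := exists_lt_of_deriv_pos (a := m - r) (b := m + r) (by linarith)
        (him _ (by simp)) h2
      exact ⟨s, abs_le.2 ⟨by linarith [hs.1], by linarith [hs.2]⟩, hs'⟩)
  have hper : ∀ (n : ℤ) t, A.1 (t - n * (2 * Real.pi)) = A.1 t := fun n t =>
    A.2.2.sub_int_mul_eq n
  have hmin' : ∀ t, Real.cos r ≤ Real.cos (t - m) → (A.1 t₀).im ≤ (A.1 t).im := fun t ht => by
    obtain ⟨n, hn⟩ := exists_add_period_abs_le hr.le ht
    rw [← hper n t]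
    exact hmin _ hn
  have hgap' : ∀ t, Real.cos r ≤ Real.cos (t - m) → Real.cos (t - m) < Real.cos r + η →
      (A.1 t₀).im + ε ≤ (A.1 t).im := fun t ht ht' => by
    obtain ⟨n, hn⟩ := exists_add_period_abs_le hr.le ht
    rw [← hper n t]
    refine hgap _ hn ?_
    rwa [show t - (n : ℝ) * (2 * Real.pi) - m = t - m - n * (2 * Real.pi) by ring,
      Real.cos_sub_int_mul_two_pi]
  -- The slope `2 / η` makes the argument equal `2` at `cos (t - m) = cos r + η`. It thus exceeds
  -- `1` strictly from there on, so `φ` is locally constant and `φ'` lives only where the gap `ε` is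
  -- available.
  obtain ⟨φ, hφ⟩ : ∃ φ : SmoothTorus, φ.1 = fun t =>
      (Real.smoothTransition (2 / η * Real.cos (t - m) + -(2 / η * Real.cos r)) : ℂ) :=
    ⟨⟨_, smoothTransition_cos_mem_smoothTorus (2 / η) (-(2 / η * Real.cos r)) m⟩, rfl⟩
  have hφ0 : ∀ t, φ.1 t ≠ 0 → Real.cos r ≤ Real.cos (t - m) := fun t ht => by
    by_contra hlt
    refine ht ?_
    rw [hφ, Complex.ofReal_eq_zero]
    refine Real.smoothTransition.zero_of_nonpos ?_
    have := mul_le_mul_of_nonneg_left (not_le.1 hlt).le (div_pos two_pos hη).le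
    linarith
  have hφd : ∀ t, deriv φ.1 t ≠ 0 →
      Real.cos r ≤ Real.cos (t - m) ∧ Real.cos (t - m) < Real.cos r + η := fun t ht => by
    by_contra hlt
    refine ht ?_
    rw [hφ]
    refine deriv_smoothTransition_eq_zero ?_ (by fun_prop) rfl
    have h2η := div_pos two_pos hη
    rcases not_and_or.1 hlt with h | h
    · left
      have := mul_lt_mul_of_pos_left (not_le.1 h) h2η
      linarith
    · right
      have := mul_le_mul_of_nonneg_left (not_lt.1 h) h2η.le
      rw [mul_add, div_mul_cancel₀ _ hη.ne'] at this
      linarith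
  have hz : (fun t => 2 * Real.pi * Complex.I * (A.1 t - A.1 t₀)) ∈ SmoothTorus :=
    ⟨contDiff_const.mul (A.2.1.sub contDiff_const), fun t => by simp only [A.2.2 t]⟩
  have hre : ∀ t, (2 * Real.pi * Complex.I * (A.1 t - A.1 t₀)).re =
      -(2 * Real.pi * ((A.1 t).im - (A.1 t₀).im)) := fun t => by
    simp
  refine not_isSchwartzGloballyHypoelliptic_of_cutoff (φ := φ) (z := ⟨_, hz⟩) (Q := Q)
    (ε := 2 * Real.pi * ε) (t₀ := t₀) (mul_pos Real.two_pi_pos hε) (fun t ht => ?_) (fun t ht => ?_)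
    ?_ ?_ (fun t => ?_) (fun t => ?_)
  · rw [hre]
    have := mul_nonneg Real.two_pi_pos.le (sub_nonneg.2 (hmin' t (hφ0 t ht)))
    linarith
  · rw [hre]
    have := hgap' t (hφd t ht).1 (hφd t ht).2
    refine neg_le_neg (mul_le_mul_of_nonneg_left ?_ Real.two_pi_pos.le)
    linarith
  · rw [hφ]
    refine Complex.ofReal_ne_zero.2 (Real.smoothTransition.pos_of_pos ?_).ne'
    have := mul_lt_mul_of_pos_left (show Real.cos r < Real.cos (t₀ - m) by linarith)
      (div_pos two_pos hη)
    linarith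
  · simp
  · by_cases ht : φ.1 t = 0
    · simp [ht]
    · obtain ⟨d, hd, he⟩ := hA t
      rw [((hd.sub_const (A.1 t₀)).const_mul (2 * Real.pi * Complex.I : ℂ)).deriv,
        he (hφ0 t ht)]
  · by_cases ht : φ.1 t = 0
    · simp [ht]
    · obtain ⟨d, hd, he⟩ := hQ t
      rw [hd.deriv, he (hφ0 t ht)]

theorem im_nonneg_or_im_nonpos_of_isSchwartzGloballyHypoelliptic {c q : SmoothTorus}
    (hL : IsSchwartzGloballyHypoelliptic (vectorFieldOp c q)) :
    (∀ t : ℝ, 0 ≤ (c.1 t).im) ∨ (∀ t : ℝ, (c.1 t).im ≤ 0) := by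
  by_contra h
  obtain ⟨h1, h2⟩ := not_or.1 h
  obtain ⟨t₁, ht₁⟩ := not_forall.1 h1
  obtain ⟨t', ht'⟩ := not_forall.1 h2
  -- Going once around the circle from `t₁` meets a point where `b > 0`, so the passage from
  -- negative to positive can always be arranged, on an arc shorter than a full turn.
  obtain ⟨t₂, ht₂, he⟩ := c.2.2.exists_mem_Ioc Real.two_pi_pos t' t₁
  rw [not_le] at ht₁
  rw [not_le, he] at ht'
  have hne : t₂ ≠ t₁ + 2 * Real.pi := fun h => by
    rw [h, c.2.2] at ht'
    linarith
  have hlt := lt_of_le_of_ne ht₂.2 hne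
  refine not_isSchwartzGloballyHypoelliptic_of_sign_change (m := (t₁ + t₂) / 2)
    (r := (t₂ - t₁) / 2) (by linarith [ht₂.1]) (by linarith) ?_ ?_ hL
  · rwa [show (t₁ + t₂) / 2 - (t₂ - t₁) / 2 = t₁ by ring]
  · rwa [show (t₁ + t₂) / 2 + (t₂ - t₁) / 2 = t₂ by ring]

end TorusLine

end

theorem theorem1 (c q : TorusLine.SmoothTorus) :
    TorusLine.IsSchwartzGloballyHypoelliptic (TorusLine.vectorFieldOp c q) ↔
      TorusLine.zeroSet (TorusLine.avg c) (TorusLine.avg q) = ∅ ∧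
        ((∀ t : ℝ, 0 ≤ (c.1 t).im) ∨ (∀ t : ℝ, (c.1 t).im ≤ 0)) :=
  ⟨fun h => ⟨TorusLine.zeroSet_eq_empty_of_isSchwartzGloballyHypoelliptic h,
    TorusLine.im_nonneg_or_im_nonpos_of_isSchwartzGloballyHypoelliptic h⟩,
    fun h => TorusLine.isSchwartzGloballyHypoelliptic_vectorFieldOp h.1 h.2⟩
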